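/- For a polynomial $f$ over $\mathbb{F}_2$ in $n$ variables let $\mathrm{gap}(f)=\sum_{x\in\{0,1\}^n}(-1)^{f(x)}=|\{x:f(x)=0\}|-|\{x:f(x)=1\}|$. A function $F$ from bit strings to natural numbers is in \#P if there is a polynomial-time computable map sending each bit string $w$ to a Boolean circuit $C_w$ (with AND, OR and NOT gates, finitely many input bits and one output bit) such that $F(w)=|\{x:C_w(x)=1\}|$ for all $w$. A function $G$ is \#P-hard to compute if every $F$ in \#P reduces to $G$ in polynomial time, in the following sense: there are polynomial-time computable maps $R$ and $S$ such that $F(w)=S(w,G(R(w)))$ for all bit strings $w$. Then it is \#P-hard to compute $\mathrm{gap}(f)$ exactly, given a multilinear polynomial $f$ of degree $3$ over $\mathbb{F}_2$ (presented by its number of variables, in unary, and the list of its monomials). -/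

import Mathlib

/-! ### Classical Boolean circuits and circuit counting -/

/-- A gate of a Boolean circuit. The arguments are the numbers of the wires it reads. -/
inductive BoolGate where
  | and (i j : ℕ)
  | or (i j : ℕ)
  | not (i : ℕ)

namespace BoolGate

/-- The wires read by a gate. -/
def inputs : BoolGate → List ℕ
  | .and i j => [i, j]
  | .or i j => [i, j]
  | .not i => [i]

/-- The output bit of a gate, given the list of the values of the wires already computed. -/
def eval (w : List Bool) : BoolGate → Bool
  | .and i j => w.getD i false && w.getD j false
  | .or i j => w.getD i false || w.getD j false
  | .not i => !(w.getD i false)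

end BoolGate

/-- A Boolean circuit with AND, OR and NOT gates, several input bits and one output bit.
Wires `0, …, numInputs - 1` are the inputs, wire `numInputs + k` is the output of gate `k`
(gates are numbered from `0`); a gate reads only inputs and outputs of earlier gates. -/
structure BoolCircuit where
  numInputs : ℕ
  gates : List BoolGate
  out : ℕ
  gates_wf : ∀ (k : ℕ) (hk : k < gates.length), ∀ i ∈ (gates[k]).inputs, i < numInputs + k
  out_wf : out < numInputs + gates.length

namespace BoolCircuit

/-- The values of all wires: start with the input bits and append the outputs of the gates. -/
def wireValues (C : BoolCircuit) (x : Fin C.numInputs → Bool) : List Bool :=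
  C.gates.foldl (fun w g => w ++ [g.eval w]) (List.ofFn x)

/-- The output bit `C(x)`. -/
def eval (C : BoolCircuit) (x : Fin C.numInputs → Bool) : Bool :=
  (C.wireValues x).getD C.out false

/-- Circuit counting: the number of inputs `x` with `C(x) = 1`. -/
def count (C : BoolCircuit) : ℕ :=
  (Finset.univ.filter (fun x : Fin C.numInputs → Bool => C.eval x = true)).card

end BoolCircuit

/-- The alphabet used to write circuits. -/
inductive CircuitSymbol where
  | tick
  | comma
  | and
  | or
  | not
  deriving DecidableEq

instance : Fintype CircuitSymbol :=
  ⟨{.tick, .comma, .and, .or, .not}, fun x => by cases x <;> simp⟩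

/-- A gate is written as its type followed by the wires it reads (in unary). -/
def BoolGate.encode : BoolGate → List CircuitSymbol
  | .and i j => .and :: (List.replicate i .tick ++ .comma :: List.replicate j .tick)
  | .or i j => .or :: (List.replicate i .tick ++ .comma :: List.replicate j .tick)
  | .not i => .not :: List.replicate i .tick

/-- A circuit is written as the number of inputs and the output wire (both in unary),
followed by its gates. -/
def BoolCircuit.encode (C : BoolCircuit) : List CircuitSymbol :=
  List.replicate C.numInputs .tick ++ .comma :: (List.replicate C.out .tick ++
    C.gates.flatMap BoolGate.encode)

/-! ### Multilinear polynomials over the field with two elements -/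

/-- The gap of a polynomial over `𝔽₂`: the sum of `(-1)^{f(x)}` over all points `x`. -/
noncomputable def gap {n : ℕ} (f : MvPolynomial (Fin n) (ZMod 2)) : ℤ :=
  ∑ x : Fin n → ZMod 2, (-1 : ℤ) ^ (MvPolynomial.eval x f).val

/-- A multilinear polynomial over `𝔽₂` in `numVars` variables, given as the list of its
monomials. There are no repeated monomials, and each monomial is given by the strictly
increasing list of its variables (the empty list is the constant monomial `1`). -/
structure F2Poly where
  numVars : ℕ
  monomials : List (List (Fin numVars))
  increasing : ∀ m ∈ monomials, m.Pairwise (· < ·)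
  nodup : monomials.Nodup

namespace F2Poly

/-- The polynomial denoted by the list of monomials. -/
noncomputable def toMvPolynomial (p : F2Poly) : MvPolynomial (Fin p.numVars) (ZMod 2) :=
  (p.monomials.map (fun m => (m.map MvPolynomial.X).prod)).sum

end F2Poly

/-- The alphabet used to write polynomials. -/
inductive PolySymbol where
  | tick
  | comma
  | plus
  deriving DecidableEq

instance : Fintype PolySymbol :=
  ⟨{.tick, .comma, .plus}, fun x => by cases x <;> simp⟩

/-- A polynomial is written as the number of variables (in unary), followed by its monomials,
each one being a `plus` followed by its variables, each one being a `comma` followed by the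
number of the variable in unary. -/
def F2Poly.encode (p : F2Poly) : List PolySymbol :=
  List.replicate p.numVars .tick ++
    p.monomials.flatMap (fun m => .plus ::
      m.flatMap (fun i => .comma :: List.replicate (i : ℕ) .tick))

/-- The polynomials over `𝔽₂` of degree `3`. -/
def CubicF2Poly : Type := {p : F2Poly // p.toMvPolynomial.totalDegree = 3}

/-- The encoding of a polynomial of degree `3`. -/
def CubicF2Poly.encode (p : CubicF2Poly) : List PolySymbol := p.1.encode

/-- The problem of computing the gap of a polynomial of degree `3`. -/
noncomputable def CubicF2Poly.gap (p : CubicF2Poly) : ℤ := _root_.gap p.1.toMvPolynomial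

/-! ### Polynomial time, the class #P, and #P-hardness -/

/-- Integers are written as a sign bit followed by the absolute value in binary. -/
def encodeInt (z : ℤ) : List Bool := decide (z < 0) :: Computability.encodeNat z.natAbs

/-- Pairs are written as the two components one after the other, over disjoint alphabets. -/
def encodePair {α β Γ Δ : Type} (ea : α → List Γ) (eb : β → List Δ) (p : α × β) :
    List (Γ ⊕ Δ) :=
  (ea p.1).map Sum.inl ++ (eb p.2).map Sum.inr

/-- `f` is computed by a (multi-tape) Turing machine in time polynomial in the length of the
encoding of its input. -/
def PolyTimeComputable {α β Γ Δ : Type} (ea : α → List Γ) (eb : β → List Δ) (f : α → β) :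
    Prop :=
  Nonempty (Turing.TM2ComputableInPolyTime ea eb f)

/-- The class #P: the functions from bit strings to natural numbers that can be expressed as
circuit counting, for a circuit that is computed from the bit string in polynomial time. -/
def InSharpP (F : List Bool → ℕ) : Prop :=
  ∃ C : List Bool → BoolCircuit,
    PolyTimeComputable id BoolCircuit.encode C ∧ ∀ x, F x = (C x).count

/-- Polynomial-time reduction of the function `F` to the function `G`: the value of `F` at `x`
is obtained in polynomial time from `x` and from the value of `G` at one instance `R x`, which is
computed from `x` in polynomial time. -/
def PolyTimeReducible {α β Γ Δ : Type} (F : List Bool → ℕ)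
    (ea : α → List Γ) (eb : β → List Δ) (G : α → β) : Prop :=
  ∃ (R : List Bool → α) (S : List Bool × β → ℕ),
    PolyTimeComputable id ea R ∧
    PolyTimeComputable (encodePair id eb) Computability.encodeNat S ∧
    ∀ x, F x = S (x, G (R x))

/-- #P-hardness of computing the function `G` (with inputs and outputs encoded by `ea`, `eb`):
every function in #P reduces to it in polynomial time. -/
def SharpPHard {α β Γ Δ : Type} (ea : α → List Γ) (eb : β → List Δ) (G : α → β) : Prop :=
  ∀ F : List Bool → ℕ, InSharpP F → PolyTimeReducible F ea eb G

/-!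
Let a circuit have `n` inputs and `m` gates. Each input and each gate gets a block of four variables
`a`, `b`, `c`, `d`. For a gate with operands `x`, `y` and output polynomial `p`, it carries the
cubic `c * (x + a) + d * (b + p(a, y))`: summing the signs over `c` and `d` gives `4` if `a = x` and
`b = p(a, y)`, and `0` otherwise, so `b` is the value of the wire. The copy `a` of the first operand
keeps the monomials multilinear even when `x` and `y` are the same wire. One more block holds a
switch `s`. For `s = 1` the inputs are free, and a further variable, multiplied by the complement of
the output, doubles the contribution of each accepted input and cancels that of the others. For
`s = 0` the inputs are forced to be zero. Hence the gap is `4 ^ (n + m + 1) * (2 * count + 1)`, and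
the count is what remains of its binary digits after the low zeros and the lowest one.

Both directions of the reduction are compiled to Turing machines from a small structured
programming language with counters.
-/
/-! ### Runs of stack machines -/

section Runs

/-- `StepsWithin f a b t`: iterating the partial function `f` leads from `a` to `b` in at most `t`
steps. This is the propositional, inductive form of `StateTransition.EvalsToInTime`. -/
inductive StepsWithin {α : Type*} (f : α → Option α) (a : α) : α → ℕ → Prop
  | refl (t : ℕ) : StepsWithin f a a t
  | tail {b c : α} {t : ℕ} : StepsWithin f a b t → f b = some c → StepsWithin f a c (t + 1)

namespace StepsWithin

variable {α β : Type*} {f : α → Option α} {a b c : α} {s t : ℕ}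

theorem single (h : f a = some b) : StepsWithin f a b 1 := (refl 0).tail h

theorem mono (h : StepsWithin f a b s) (hst : s ≤ t) : StepsWithin f a b t := by
  induction h generalizing t with
  | refl => exact refl t
  | tail _ hbc ih =>
    obtain ⟨t, rfl⟩ := Nat.exists_eq_add_of_le' (Nat.one_le_of_lt hst)
    exact (ih (Nat.le_of_succ_le_succ hst)).tail hbc

theorem trans (hab : StepsWithin f a b s) (hbc : StepsWithin f b c t) :
    StepsWithin f a c (s + t) := by
  induction hbc with
  | refl => exact hab.mono (Nat.le_add_right _ _)
  | tail _ h ih => exact ih.tail h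

theorem map {g : β → Option β} (φ : α → β)
    (hφ : ∀ ⦃a b⦄, f a = some b → g (φ a) = some (φ b)) (h : StepsWithin f a b t) :
    StepsWithin g (φ a) (φ b) t := by
  induction h with
  | refl t => exact refl t
  | tail _ h ih => exact ih.tail (hφ h)

theorem nonempty_evalsToInTime (h : StepsWithin f a b t) :
    Nonempty (StateTransition.EvalsToInTime f a (some b) t) := by
  induction h with
  | refl t => exact ⟨⟨0, rfl⟩, t.zero_le⟩
  | tail _ h ih =>
    obtain ⟨⟨s, hs⟩, hst⟩ := ih
    refine ⟨⟨s + 1, ?_⟩, Nat.succ_le_succ hst⟩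
    rw [Function.iterate_succ_apply', hs]
    exact h

theorem of_iterate_eq_some (h : (flip bind f)^[t] (some a) = some b) : StepsWithin f a b t := by
  induction t generalizing b with
  | zero => cases h; exact refl 0
  | succ t ih =>
    rw [Function.iterate_succ_apply'] at h
    obtain ⟨c, hac, hcb⟩ := Option.bind_eq_some_iff.1 h
    exact (ih hac).tail hcb

theorem of_evalsToInTime (h : StateTransition.EvalsToInTime f a (some b) t) :
    StepsWithin f a b t :=
  (of_iterate_eq_some h.evals_in_steps).mono h.steps_le_m

end StepsWithin

end Runs

section PushBound

open Turing

variable {K : Type*} {Γ : K → Type*} {Λ σ : Type*}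

/-- An upper bound for the number of symbols that the execution of a statement pushes. -/
def pushBound : TM2.Stmt Γ Λ σ → ℕ
  | .push _ _ q => pushBound q + 1
  | .peek _ _ q => pushBound q
  | .pop _ _ q => pushBound q
  | .load _ q => pushBound q
  | .branch _ q₁ q₂ => pushBound q₁ + pushBound q₂
  | .goto _ => 0
  | .halt => 0

variable [DecidableEq K]

theorem length_stk_stepAux_le (q : TM2.Stmt Γ Λ σ) (v : σ) (S : ∀ k, List (Γ k)) (k : K) :
    ((TM2.stepAux q v S).stk k).length ≤ (S k).length + pushBound q := by
  induction q generalizing v S with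
  | push k' f q ih =>
    refine (ih _ _).trans ?_
    obtain rfl | hk := eq_or_ne k k'
    · simp only [Function.update_self, List.length_cons, pushBound]
      omega
    · simp only [Function.update_of_ne hk, pushBound]
      omega
  | peek k' f _ ih => exact ih _ _
  | pop k' f q ih =>
    refine (ih _ _).trans ?_
    obtain rfl | hk := eq_or_ne k k'
    · simp [pushBound]
    · simp [pushBound, hk]
  | load f _ ih => exact ih _ _
  | branch f q₁ q₂ ih₁ ih₂ =>
    simp only [TM2.stepAux, pushBound]
    cases f v
    · exact (ih₂ _ _).trans (by omega)
    · exact (ih₁ _ _).trans (by omega)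
  | goto f => exact Nat.le_add_right _ _
  | halt => exact Nat.le_add_right _ _

theorem length_stk_le_of_stepsWithin [Fintype Λ] {M : Λ → TM2.Stmt Γ Λ σ} {c c' : TM2.Cfg Γ Λ σ}
    {t : ℕ} (h : StepsWithin (TM2.step M) c c' t) (k : K) :
    (c'.stk k).length ≤ (c.stk k).length + t * ∑ l, pushBound (M l) := by
  induction h with
  | refl => exact Nat.le_add_right _ _
  | @tail b c' t _ hstep ih =>
    obtain ⟨_ | l, v, S⟩ := b
    · cases hstep
    · obtain rfl := Option.some.inj hstep
      have hl : pushBound (M l) ≤ ∑ l, pushBound (M l) :=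
        Finset.single_le_sum (f := fun l => pushBound (M l)) (fun _ _ => Nat.zero_le _)
          (Finset.mem_univ l)
      calc _ ≤ (S k).length + pushBound (M l) := length_stk_stepAux_le (M l) v S k
        _ ≤ (c.stk k).length + t * ∑ l, pushBound (M l) + ∑ l, pushBound (M l) :=
          Nat.add_le_add ih hl
        _ = _ := by ring

end PushBound

section Embedding

open Turing

variable {K K' : Type*} {Γ' : K' → Type*} {Λ Λ' σ σ' : Type*}

/-- Rewrite a statement for another machine: the stacks are renamed by `κ`, the internal state is
read by `get` and written by `set`, labels are renamed by `lab`, and instead of halting the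
machine goes on at `fin`. -/
def embedStmt (κ : K → K') (get : σ' → σ) (set : σ' → σ → σ') (lab : Λ → Λ')
    (fin : Option Λ') : TM2.Stmt (fun k => Γ' (κ k)) Λ σ → TM2.Stmt Γ' Λ' σ'
  | .push k f q => .push (κ k) (fun v => f (get v)) (embedStmt κ get set lab fin q)
  | .peek k f q =>
    .peek (κ k) (fun v o => set v (f (get v) o)) (embedStmt κ get set lab fin q)
  | .pop k f q => .pop (κ k) (fun v o => set v (f (get v) o)) (embedStmt κ get set lab fin q)
  | .load f q => .load (fun v => set v (f (get v))) (embedStmt κ get set lab fin q)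
  | .branch f q₁ q₂ => .branch (fun v => f (get v)) (embedStmt κ get set lab fin q₁)
      (embedStmt κ get set lab fin q₂)
  | .goto f => .goto fun v => lab (f (get v))
  | .halt => fin.elim .halt fun l => .goto fun _ => l

/-- The configuration of the larger machine that corresponds to a configuration of the embedded
one: `put` and `stk` embed the internal state and the stacks. -/
def embedCfg {κ : K → K'} (put : σ → σ') (stk : (∀ k, List (Γ' (κ k))) → ∀ k, List (Γ' k))
    (lab : Λ → Λ') (fin : Option Λ') (c : TM2.Cfg (fun k => Γ' (κ k)) Λ σ) : TM2.Cfg Γ' Λ' σ' :=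
  ⟨c.l.elim fin fun l => some (lab l), put c.var, stk c.stk⟩

variable [DecidableEq K] [DecidableEq K']

theorem stepAux_embedStmt {κ : K → K'} {get : σ' → σ} {set : σ' → σ → σ'} {lab : Λ → Λ'}
    {fin : Option Λ'} {put : σ → σ'} {stk : (∀ k, List (Γ' (κ k))) → ∀ k, List (Γ' k)}
    (get_put : ∀ v, get (put v) = v) (set_put : ∀ v w, set (put v) w = put w)
    (stk_apply : ∀ S k, stk S (κ k) = S k)
    (update_stk : ∀ S k x, Function.update (stk S) (κ k) x = stk (Function.update S k x))
    (q : TM2.Stmt (fun k => Γ' (κ k)) Λ σ) (v : σ) (S : ∀ k, List (Γ' (κ k))) :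
    TM2.stepAux (embedStmt κ get set lab fin q) (put v) (stk S) =
      embedCfg put stk lab fin (TM2.stepAux q v S) := by
  induction q generalizing v S with
  | push k f q ih => simp only [embedStmt, TM2.stepAux, get_put, stk_apply, update_stk, ih]
  | peek k f q ih => simp only [embedStmt, TM2.stepAux, get_put, set_put, stk_apply, ih]
  | pop k f q ih =>
    simp only [embedStmt, TM2.stepAux, get_put, set_put, stk_apply, update_stk, ih]
  | load f q ih => simp only [embedStmt, TM2.stepAux, get_put, set_put, ih]
  | branch f q₁ q₂ ih₁ ih₂ =>
    simp only [embedStmt, TM2.stepAux, get_put]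
    cases f v
    · exact ih₂ _ _
    · exact ih₁ _ _
  | goto f => simp only [embedStmt, TM2.stepAux, embedCfg, get_put, Option.elim]
  | halt => cases fin <;> rfl

theorem step_embedCfg {κ : K → K'} {get : σ' → σ} {set : σ' → σ → σ'} {lab : Λ → Λ'}
    {fin : Option Λ'} {put : σ → σ'} {stk : (∀ k, List (Γ' (κ k))) → ∀ k, List (Γ' k)}
    (get_put : ∀ v, get (put v) = v) (set_put : ∀ v w, set (put v) w = put w)
    (stk_apply : ∀ S k, stk S (κ k) = S k)
    (update_stk : ∀ S k x, Function.update (stk S) (κ k) x = stk (Function.update S k x))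
    {M : Λ → TM2.Stmt (fun k => Γ' (κ k)) Λ σ} {M' : Λ' → TM2.Stmt Γ' Λ' σ'}
    (hM : ∀ l, M' (lab l) = embedStmt κ get set lab fin (M l))
    {c d : TM2.Cfg (fun k => Γ' (κ k)) Λ σ} (h : TM2.step M c = some d) :
    TM2.step M' (embedCfg put stk lab fin c) = some (embedCfg put stk lab fin d) := by
  obtain ⟨_ | l, v, S⟩ := c
  · cases h
  · obtain rfl := Option.some.inj h
    refine congrArg some (Eq.trans ?_
      (stepAux_embedStmt get_put set_put stk_apply update_stk (M l) v S))
    rw [← hM]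

end Embedding
/-! ### Composition of Turing machines -/

namespace Tandem

open Turing

/-- The two loops that move the intermediate word: `unload` pops it from the output stack of the
first machine, `load` pushes it on the input stack of the second machine. -/
inductive Transfer
  | unload
  | load
  deriving DecidableEq

instance : Fintype Transfer :=
  ⟨{.unload, .load}, fun x => by cases x <;> simp⟩

section Stacks

variable (M₁ M₂ : FinTM2) (B : Type)

/-- The stack alphabets of two machines run one after the other: those of both machines, and one
auxiliary stack that reverses the intermediate word on its way from the first to the second. -/
abbrev Symbol : M₁.K ⊕ M₂.K ⊕ Unit → Type
  | .inl k => M₁.Γ k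
  | .inr (.inl k) => M₂.Γ k
  | .inr (.inr _) => B

/-- The internal states of two machines run one after the other, with a register for the symbol
that is being moved from the first to the second. -/
abbrev State : Type := M₁.σ × M₂.σ × Option B

/-- The labels of two machines run one after the other. -/
abbrev Label : Type := M₁.Λ ⊕ M₂.Λ ⊕ Transfer

variable {M₁ M₂ B}

/-- The stacks of both machines and the auxiliary stack, joined into one family. -/
def joinStk (S₁ : ∀ k, List (M₁.Γ k)) (S₂ : ∀ k, List (M₂.Γ k)) (T : List B) :
    ∀ k, List (Symbol M₁ M₂ B k)
  | .inl k => S₁ k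
  | .inr (.inl k) => S₂ k
  | .inr (.inr _) => T

theorem joinStk_nil : (joinStk (fun _ => []) (fun _ => []) [] : ∀ k, List (Symbol M₁ M₂ B k)) =
    fun _ => [] := by
  funext k
  rcases k with k | k | k <;> rfl

variable (S₁ : ∀ k, List (M₁.Γ k)) (S₂ : ∀ k, List (M₂.Γ k)) (T : List B)

theorem update_joinStk_fst (k : M₁.K) (w : List (M₁.Γ k)) :
    Function.update (joinStk S₁ S₂ T) (.inl k) w = joinStk (Function.update S₁ k w) S₂ T := by
  funext k'
  rcases k' with k' | k' | k'
  · obtain rfl | h := eq_or_ne k' k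
    · simp [joinStk]
    · simp [joinStk, h]
  · simp [joinStk]
  · simp [joinStk]

theorem update_joinStk_snd (k : M₂.K) (w : List (M₂.Γ k)) :
    Function.update (joinStk S₁ S₂ T) (.inr (.inl k)) w =
      joinStk S₁ (Function.update S₂ k w) T := by
  funext k'
  rcases k' with k' | k' | k'
  · simp [joinStk]
  · obtain rfl | h := eq_or_ne k' k
    · simp [joinStk]
    · simp [joinStk, h]
  · simp [joinStk]

theorem update_joinStk_aux (w : List B) :
    Function.update (joinStk S₁ S₂ T) (.inr (.inr ())) w = joinStk S₁ S₂ w := by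
  funext k'
  rcases k' with k' | k' | k' <;> simp [joinStk]

end Stacks

variable (M₁ M₂ : FinTM2) {B : Type} [Inhabited B] (e₁ : M₁.Γ M₁.k₁ ≃ B) (e₂ : M₂.Γ M₂.k₀ ≃ B)

/-- The program of two machines run one after the other. The default symbol of `B` is never
pushed, because the register is nonempty at every push. -/
def program : Label M₁ M₂ → TM2.Stmt (Symbol M₁ M₂ B) (Label M₁ M₂) (State M₁ M₂ B)
  | .inl l => embedStmt (Γ' := Symbol M₁ M₂ B) Sum.inl (fun v => v.1) (fun v w => (w, v.2))
      Sum.inl (some (.inr (.inr .unload))) (M₁.m l)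
  | .inr (.inl l) => embedStmt (Γ' := Symbol M₁ M₂ B) (fun k => Sum.inr (Sum.inl k))
      (fun v => v.2.1) (fun v w => (v.1, w, v.2.2)) (fun l => Sum.inr (Sum.inl l)) none (M₂.m l)
  | .inr (.inr .unload) =>
    .pop (.inl M₁.k₁) (fun v o => (v.1, v.2.1, o.map e₁)) <|
    .branch (fun v => v.2.2.isSome)
      (.push (.inr (.inr ())) (fun v => v.2.2.getD default) <|
        .load (fun v => (v.1, v.2.1, none)) <| .goto fun _ => .inr (.inr .unload))
      (.goto fun _ => .inr (.inr .load))
  | .inr (.inr .load) =>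
    .pop (.inr (.inr ())) (fun v o => (v.1, v.2.1, o)) <|
    .branch (fun v => v.2.2.isSome)
      (.push (.inr (.inl M₂.k₀)) (fun v => e₂.symm (v.2.2.getD default)) <|
        .load (fun v => (v.1, v.2.1, none)) <| .goto fun _ => .inr (.inr .load))
      (.goto fun _ => .inr (.inl M₂.main))

section Transfer

variable (v₁ : M₁.σ) (v₂ : M₂.σ) (S₁ : ∀ k, List (M₁.Γ k)) (S₂ : ∀ k, List (M₂.Γ k)) (w : List B)

theorem stepsWithin_unload (T : List B) :
    StepsWithin (TM2.step (program M₁ M₂ e₁ e₂))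
      ⟨some (.inr (.inr .unload)), (v₁, v₂, none),
        joinStk (Function.update S₁ M₁.k₁ (w.map e₁.symm)) S₂ T⟩
      ⟨some (.inr (.inr .load)), (v₁, v₂, none),
        joinStk (Function.update S₁ M₁.k₁ []) S₂ (w.reverse ++ T)⟩ (w.length + 1) := by
  induction w generalizing T with
  | nil =>
    refine .single ?_
    simp only [TM2.step, program, TM2.stepAux, update_joinStk_fst]
    simp [joinStk]
  | cons b w ih =>
    rw [List.length_cons, add_comm, List.reverse_cons, List.append_assoc]
    refine .trans (.single ?_) (ih (b :: T))
    simp only [TM2.step, program, TM2.stepAux, update_joinStk_fst, update_joinStk_aux]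
    simp [joinStk]

theorem stepsWithin_load (T : List (M₂.Γ M₂.k₀)) :
    StepsWithin (TM2.step (program M₁ M₂ e₁ e₂))
      ⟨some (.inr (.inr .load)), (v₁, v₂, none), joinStk S₁ (Function.update S₂ M₂.k₀ T) w⟩
      ⟨some (.inr (.inl M₂.main)), (v₁, v₂, none),
        joinStk S₁ (Function.update S₂ M₂.k₀ ((w.map e₂.symm).reverse ++ T)) []⟩
        (w.length + 1) := by
  induction w generalizing T with
  | nil =>
    refine .single ?_
    simp only [TM2.step, program, TM2.stepAux, update_joinStk_aux]
    simp [joinStk]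
  | cons b w ih =>
    rw [List.length_cons, add_comm, List.map_cons, List.reverse_cons, List.append_assoc]
    refine .trans (.single ?_) (ih (e₂.symm b :: T))
    simp only [TM2.step, program, TM2.stepAux, update_joinStk_snd, update_joinStk_aux]
    simp [joinStk]

end Transfer

/-- The joint configuration while the first machine is running. -/
def cfgFst (c : M₁.Cfg) : TM2.Cfg (Symbol M₁ M₂ B) (Label M₁ M₂) (State M₁ M₂ B) :=
  embedCfg (Γ' := Symbol M₁ M₂ B) (κ := Sum.inl) (fun v => (v, M₂.initialState, none))
    (fun S => joinStk S (fun _ => []) []) Sum.inl (some (.inr (.inr .unload))) c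

/-- The joint configuration while the second machine is running. -/
def cfgSnd (c : M₂.Cfg) : TM2.Cfg (Symbol M₁ M₂ B) (Label M₁ M₂) (State M₁ M₂ B) :=
  embedCfg (Γ' := Symbol M₁ M₂ B) (κ := fun k => Sum.inr (Sum.inl k))
    (fun v => (M₁.initialState, v, none)) (fun S => joinStk (fun _ => []) S [])
    (fun l => Sum.inr (Sum.inl l)) none c

theorem step_cfgFst ⦃c d : M₁.Cfg⦄ (h : M₁.step c = some d) :
    TM2.step (program M₁ M₂ e₁ e₂) (cfgFst M₁ M₂ c) = some (cfgFst M₁ M₂ d) :=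
  step_embedCfg (Γ' := Symbol M₁ M₂ B) (κ := Sum.inl) (get := fun v : State M₁ M₂ B => v.1)
    (set := fun v w => (w, v.2)) (lab := Sum.inl)
    (fin := some (Sum.inr (Sum.inr Transfer.unload))) (put := fun v => (v, M₂.initialState, none))
    (stk := fun S => joinStk S (fun _ => []) []) (fun _ => rfl) (fun _ _ => rfl) (fun _ _ => rfl)
    (fun S => update_joinStk_fst S _ _) (M := M₁.m) (fun _ => rfl) h

theorem step_cfgSnd ⦃c d : M₂.Cfg⦄ (h : M₂.step c = some d) :
    TM2.step (program M₁ M₂ e₁ e₂) (cfgSnd M₁ M₂ c) = some (cfgSnd M₁ M₂ d) :=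
  step_embedCfg (Γ' := Symbol M₁ M₂ B) (κ := fun k => Sum.inr (Sum.inl k))
    (get := fun v : State M₁ M₂ B => v.2.1) (set := fun v w => (v.1, w, v.2.2))
    (lab := fun l => Sum.inr (Sum.inl l)) (fin := none)
    (put := fun v => (M₁.initialState, v, none)) (stk := fun S => joinStk (fun _ => []) S [])
    (fun _ => rfl) (fun _ _ => rfl) (fun _ _ => rfl) (fun S => update_joinStk_snd _ S _)
    (M := M₂.m) (fun _ => rfl) h

attribute [local instance] FinTM2.kFin FinTM2.ΛFin FinTM2.σFin FinTM2.Γk₀Fin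

/-- The machine that runs the second machine on the output of the first. -/
def machine [Fintype B] : FinTM2 where
  K := M₁.K ⊕ M₂.K ⊕ Unit
  k₀ := .inl M₁.k₀
  k₁ := .inr (.inl M₂.k₁)
  Γ := Symbol M₁ M₂ B
  Λ := Label M₁ M₂
  main := .inl M₁.main
  σ := State M₁ M₂ B
  initialState := (M₁.initialState, M₂.initialState, none)
  Γk₀Fin := M₁.Γk₀Fin
  m := program M₁ M₂ e₁ e₂

end Tandem

section InitHalt

open Turing

variable (M : FinTM2)

theorem stk_initList (w : List (M.Γ M.k₀)) :
    (initList M w).stk = Function.update (fun _ => []) M.k₀ w := by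
  funext k
  obtain rfl | h := eq_or_ne k M.k₀
  · simp [initList]
  · simp [initList, h]

theorem stk_haltList (w : List (M.Γ M.k₁)) :
    (haltList M w).stk = Function.update (fun _ => []) M.k₁ w := by
  funext k
  obtain rfl | h := eq_or_ne k M.k₁
  · simp [haltList]
  · simp [haltList, h]

end InitHalt

namespace Tandem

open Turing

variable (M₁ M₂ : FinTM2) {B : Type} [Inhabited B] [Fintype B]
  (e₁ : M₁.Γ M₁.k₁ ≃ B) (e₂ : M₂.Γ M₂.k₀ ≃ B)

theorem initList_machine (w : List (M₁.Γ M₁.k₀)) :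
    initList (machine M₁ M₂ e₁ e₂) w = cfgFst M₁ M₂ (initList M₁ w) := by
  refine congrArg (TM2.Cfg.mk _ _) ((stk_initList _ _).trans ?_)
  change _ = joinStk (initList M₁ w).stk _ _
  rw [stk_initList, ← update_joinStk_fst, joinStk_nil]
  rfl

theorem haltList_machine (w : List (M₂.Γ M₂.k₁)) :
    haltList (machine M₁ M₂ e₁ e₂) w = cfgSnd M₁ M₂ (haltList M₂ w) := by
  refine congrArg (TM2.Cfg.mk _ _) ((stk_haltList _ _).trans ?_)
  change _ = joinStk _ (haltList M₂ w).stk _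
  rw [stk_haltList, ← update_joinStk_snd, joinStk_nil]
  rfl

theorem stepsWithin_transfer (w : List B) :
    StepsWithin (machine M₁ M₂ e₁ e₂).step (cfgFst M₁ M₂ (haltList M₁ (w.map e₁.symm)))
      (cfgSnd M₁ M₂ (initList M₂ (w.map e₂.symm))) (2 * (w.length + 1)) := by
  have hunload := stepsWithin_unload M₁ M₂ e₁ e₂ M₁.initialState M₂.initialState (fun _ => [])
    (fun _ => []) w []
  have hload := stepsWithin_load M₁ M₂ e₁ e₂ M₁.initialState M₂.initialState (fun _ => [])
    (fun _ => []) w.reverse []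
  rw [Function.update_eq_self_iff.2 rfl, ← stk_haltList, List.append_nil] at hunload
  rw [Function.update_eq_self_iff.2 rfl, List.map_reverse, List.reverse_reverse, List.append_nil,
    ← stk_initList, List.length_reverse] at hload
  rw [two_mul]
  exact hunload.trans hload

theorem stepsWithin_machine {u : List (M₁.Γ M₁.k₀)} {w : List B} {y : List (M₂.Γ M₂.k₁)}
    {t₁ t₂ : ℕ}
    (h₁ : StepsWithin M₁.step (initList M₁ u) (haltList M₁ (w.map e₁.symm)) t₁)
    (h₂ : StepsWithin M₂.step (initList M₂ (w.map e₂.symm)) (haltList M₂ y) t₂) :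
    StepsWithin (machine M₁ M₂ e₁ e₂).step (initList (machine M₁ M₂ e₁ e₂) u)
      (haltList (machine M₁ M₂ e₁ e₂) y) (t₁ + 2 * (w.length + 1) + t₂) := by
  rw [initList_machine, haltList_machine]
  exact ((h₁.map _ (step_cfgFst M₁ M₂ e₁ e₂)).trans (stepsWithin_transfer M₁ M₂ e₁ e₂ w)).trans
    (h₂.map _ (step_cfgSnd M₁ M₂ e₁ e₂))

end Tandem

section PolyTime

open Turing Polynomial

theorem exists_length_output_le (M : FinTM2) :
    ∃ c, ∀ {u w t}, StepsWithin M.step (initList M u) (haltList M w) t →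
      w.length ≤ u.length + t * c := by
  let _ : Fintype M.Λ := M.ΛFin
  refine ⟨∑ l, pushBound (M.m l), fun {u w t} h => ?_⟩
  have hle := length_stk_le_of_stepsWithin h M.k₁
  rw [stk_haltList, stk_initList, Function.update_self] at hle
  refine hle.trans (Nat.add_le_add_right ?_ _)
  obtain heq | hne := eq_or_ne M.k₁ M.k₀
  · rw [heq, Function.update_self]
  · simp [Function.update_of_ne hne]

theorem monotone_eval_nat (p : ℕ[X]) : Monotone fun n => p.eval n := by
  intro m n hmn
  simp only [eval_eq_sum]
  exact Finset.sum_le_sum fun i _ => Nat.mul_le_mul_left _ (Nat.pow_le_pow_left hmn i)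

/-- The second machine is fast on the output of the first because that output is at most
polynomially longer than the input: every step pushes boundedly many symbols. -/
theorem PolyTimeComputable.comp {α β γ A B C : Type} [Inhabited B] {ea : α → List A}
    {eb : β → List B} {ec : γ → List C} {f : α → β} {g : β → γ}
    (hg : PolyTimeComputable eb ec g) (hf : PolyTimeComputable ea eb f) :
    PolyTimeComputable ea ec (g ∘ f) := by
  obtain ⟨F⟩ := hf
  obtain ⟨G⟩ := hg
  let _ : Fintype B := @Fintype.ofEquiv _ _ G.tm.Γk₀Fin G.inputAlphabet
  obtain ⟨c, hc⟩ := exists_length_output_le F.tm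
  let len : ℕ[X] := X + F.time * Polynomial.C c
  have run (a : α) := by
    have hF := StepsWithin.of_evalsToInTime (F.outputsFun a)
    have hG := StepsWithin.of_evalsToInTime (G.outputsFun (f a))
    have hlen : (eb (f a)).length ≤ len.eval (ea a).length := by
      simpa [len] using hc hF
    refine ((Tandem.stepsWithin_machine F.tm G.tm F.outputAlphabet G.inputAlphabet hF hG).mono
      (t := (F.time + 2 * (len + 1) + G.time.comp len).eval (ea a).length)
      ?_).nonempty_evalsToInTime
    have htime := monotone_eval_nat G.time hlen
    simp only [eval_add, eval_mul, eval_ofNat, eval_one, eval_comp]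
    gcongr
  exact ⟨⟨⟨Tandem.machine F.tm G.tm F.outputAlphabet G.inputAlphabet, F.inputAlphabet,
    G.outputAlphabet⟩, F.time + 2 * (len + 1) + G.time.comp len, fun a => (run a).some⟩⟩

end PolyTime
/-! ### Structured programs with counters -/

/-- Structured programs for a machine that reads a word over `A` from an input stack, writes
a word over `B` on an output stack, from its last letter to its first, and has a family `C` of
counters and a register in `R`. Such programs compile to Turing machines with unary counters. -/
inductive CounterProgram (A B C R : Type) where
  | write (f : R → B)
  | read (f : R → Option A → R)
  | load (f : R → R)
  | inc (c : C)
  | seq (p q : CounterProgram A B C R)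
  | ite (b : R → Bool) (p q : CounterProgram A B C R)
  | whileInp (b : Option A → Bool) (p : CounterProgram A B C R)
  | whileCtr (c : C) (p : CounterProgram A B C R)

namespace CounterProgram

open Turing

variable {A B C R L : Type}

/-- The states of a structured program: the register, the rest of the input, the output written
so far, and the counters. -/
structure State (A B C R : Type) where
  reg : R
  inp : List A
  out : List B
  ctr : C → ℕ

/-- `Exec p s s' t`: the program `p`, started in `s`, ends in `s'` after at most `t` steps. The loop
`whileCtr c p` decrements the counter `c` before each execution of `p`, until `c` is zero. -/
inductive Exec [DecidableEq C] :
    CounterProgram A B C R → State A B C R → State A B C R → ℕ → Prop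
  | write (f s) : Exec (.write f) s { s with out := f s.reg :: s.out } 1
  | read (f s) : Exec (.read f) s { s with reg := f s.reg s.inp.head?, inp := s.inp.tail } 1
  | load (f s) : Exec (.load f) s { s with reg := f s.reg } 1
  | inc (c s) : Exec (.inc c) s { s with ctr := Function.update s.ctr c (s.ctr c + 1) } 1
  | seq {p q s s' s'' t t'} : Exec p s s' t → Exec q s' s'' t' → Exec (.seq p q) s s'' (t + t')
  | ite_true {b p q s s' t} : b s.reg = true → Exec p s s' t → Exec (.ite b p q) s s' (t + 1)
  | ite_false {b p q s s' t} : b s.reg = false → Exec q s s' t → Exec (.ite b p q) s s' (t + 1)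
  | whileInp_done {b p s} : b s.inp.head? = false → Exec (.whileInp b p) s s 1
  | whileInp_step {b p s s' s'' t t'} : b s.inp.head? = true → Exec p s s' t →
      Exec (.whileInp b p) s' s'' t' → Exec (.whileInp b p) s s'' (t + t' + 1)
  | whileCtr_done {c p s} : s.ctr c = 0 → Exec (.whileCtr c p) s s 1
  | whileCtr_step {c p n s s' s'' t t'} : s.ctr c = n + 1 →
      Exec p { s with ctr := Function.update s.ctr c n } s' t →
      Exec (.whileCtr c p) s' s'' t' → Exec (.whileCtr c p) s s'' (t + t' + 1)
  | mono {p s s' t t'} : Exec p s s' t → t ≤ t' → Exec p s s' t'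

/-- The labels of the machine for a program. -/
def Label : CounterProgram A B C R → Type
  | .write _ => Unit
  | .read _ => Unit
  | .load _ => Unit
  | .inc _ => Unit
  | .seq p q => Label p ⊕ Label q
  | .ite _ p q => Option (Label p ⊕ Label q)
  | .whileInp _ p => Option (Label p)
  | .whileCtr _ p => Option (Label p)

instance Label.instFinite : ∀ p : CounterProgram A B C R, Finite (Label p)
  | .write _ => inferInstanceAs (Finite Unit)
  | .read _ => inferInstanceAs (Finite Unit)
  | .load _ => inferInstanceAs (Finite Unit)
  | .inc _ => inferInstanceAs (Finite Unit)
  | .seq p q =>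
    have := instFinite p
    have := instFinite q
    inferInstanceAs (Finite (Label p ⊕ Label q))
  | .ite _ p q =>
    have := instFinite p
    have := instFinite q
    inferInstanceAs (Finite (Option (Label p ⊕ Label q)))
  | .whileInp _ p =>
    have := instFinite p
    inferInstanceAs (Finite (Option (Label p)))
  | .whileCtr _ p =>
    have := instFinite p
    inferInstanceAs (Finite (Option (Label p)))

/-- The label where a program starts. -/
def entry : (p : CounterProgram A B C R) → Label p
  | .write _ => ()
  | .read _ => ()
  | .load _ => ()
  | .inc _ => ()
  | .seq p _ => Sum.inl (entry p)
  | .ite _ _ _ => (none : Option _)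
  | .whileInp _ _ => (none : Option _)
  | .whileCtr _ _ => (none : Option _)

/-- The stack alphabets: `none` is the input stack, `some none` is the output stack, and
`some (some c)` is the counter `c`. -/
abbrev Symbol (A B C : Type) : Option (Option C) → Type
  | none => A
  | some none => B
  | some (some _) => Unit

/-- The statements of the machine for a program. The internal state consists of the register and
of a flag, which is `false` except during the test of a loop. -/
abbrev Stmt (A B C R L : Type) : Type := TM2.Stmt (Symbol A B C) L (R × Bool)

/-- Go to `yes` or to `no`, depending on the first symbol of the input. -/
def testInp (b : Option A → Bool) (yes no : L) : Stmt A B C R L :=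
  .peek none (fun v o => (v.1, b o)) <| .branch (fun v => v.2)
    (.load (fun v => (v.1, false)) <| .goto fun _ => yes) (.goto fun _ => no)

/-- Decrement the counter and go to `yes` if it is positive, and go to `no` otherwise. -/
def testCtr (c : C) (yes no : L) : Stmt A B C R L :=
  .pop (some (some c)) (fun v o => (v.1, o.isSome)) <| .branch (fun v => v.2)
    (.load (fun v => (v.1, false)) <| .goto fun _ => yes) (.goto fun _ => no)

/-- The statements for a program that is part of a machine with labels `L`: its own labels are
embedded by `emb`, and it continues at `exit` when it is done. -/
def stmt : (p : CounterProgram A B C R) → (Label p → L) → L → Label p → Stmt A B C R L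
  | .write f, _, exit, _ => .push (some none) (fun v => f v.1) <| .goto fun _ => exit
  | .read f, _, exit, _ => .pop none (fun v o => (f v.1 o, v.2)) <| .goto fun _ => exit
  | .load f, _, exit, _ => .load (fun v => (f v.1, v.2)) <| .goto fun _ => exit
  | .inc c, _, exit, _ => .push (some (some c)) (fun _ => ()) <| .goto fun _ => exit
  | .seq p q, emb, exit, l =>
    match l with
    | .inl l => stmt p (fun l => emb (Sum.inl l)) (emb (Sum.inr (entry q))) l
    | .inr l => stmt q (fun l => emb (Sum.inr l)) exit l
  | .ite b p q, emb, exit, l =>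
    match l with
    | none => .goto fun v =>
      bif b v.1 then emb (some (Sum.inl (entry p))) else emb (some (Sum.inr (entry q)))
    | some (.inl l) => stmt p (fun l => emb (some (Sum.inl l))) exit l
    | some (.inr l) => stmt q (fun l => emb (some (Sum.inr l))) exit l
  | .whileInp b p, emb, exit, l =>
    match l with
    | none => testInp b (emb (some (entry p))) exit
    | some l => stmt p (fun l => emb (some l)) (emb (none : Option _)) l
  | .whileCtr c p, emb, exit, l =>
    match l with
    | none => testCtr c (emb (some (entry p))) exit
    | some l => stmt p (fun l => emb (some l)) (emb (none : Option _)) l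

namespace State

/-- The stacks that represent a state. -/
def stk (s : State A B C R) : ∀ k, List (Symbol A B C k)
  | none => s.inp
  | some none => s.out
  | some (some c) => List.replicate (s.ctr c) ()

/-- The configuration with label `l` that represents a state. -/
def toCfg (l : Option L) (s : State A B C R) : TM2.Cfg (Symbol A B C) L (R × Bool) :=
  ⟨l, (s.reg, false), s.stk⟩

variable [DecidableEq C]

theorem update_stk_inp (s : State A B C R) (w : List A) :
    Function.update s.stk none w = { s with inp := w }.stk := by
  funext k
  rcases k with _ | _ | c <;> simp [stk]

theorem update_stk_out (s : State A B C R) (w : List B) :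
    Function.update s.stk (some none) w = { s with out := w }.stk := by
  funext k
  rcases k with _ | _ | c <;> simp [stk]

theorem update_stk_ctr (s : State A B C R) (c : C) (n : ℕ) :
    Function.update s.stk (some (some c)) (List.replicate n ()) =
      { s with ctr := Function.update s.ctr c n }.stk := by
  funext k
  rcases k with _ | _ | c'
  · simp [stk]
  · simp [stk]
  · obtain rfl | h := eq_or_ne c' c
    · simp [stk]
    · simp [stk, h]

theorem step_toCfg {M : L → Stmt A B C R L} {l : L} {q : Stmt A B C R L} (h : M l = q)
    (s : State A B C R) :
    TM2.step M (s.toCfg (some l)) = some (TM2.stepAux q (s.reg, false) s.stk) :=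
  congrArg (fun q => some (TM2.stepAux q (s.reg, false) s.stk)) h

theorem stepAux_testInp (b : Option A → Bool) (yes no : L) (s : State A B C R) :
    TM2.stepAux (testInp b yes no) (s.reg, false) s.stk =
      s.toCfg (some (bif b s.inp.head? then yes else no)) := by
  cases h : b s.inp.head? <;> simp [testInp, stk, toCfg, h]

theorem stepAux_testCtr_zero {c : C} {s : State A B C R} (h : s.ctr c = 0) (yes no : L) :
    TM2.stepAux (testCtr c yes no) (s.reg, false) s.stk = s.toCfg (some no) := by
  simp [testCtr, stk, toCfg, h]

theorem stepAux_testCtr_succ {c : C} {n : ℕ} {s : State A B C R} (h : s.ctr c = n + 1)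
    (yes no : L) :
    TM2.stepAux (testCtr c yes no) (s.reg, false) s.stk =
      { s with ctr := Function.update s.ctr c n }.toCfg (some yes) := by
  simp only [toCfg, ← update_stk_ctr]
  simp [testCtr, stk, h, List.replicate_succ]

end State

open State

theorem Exec.stepsWithin [DecidableEq C] {M : L → Stmt A B C R L} {p : CounterProgram A B C R}
    {s s' : State A B C R} {t : ℕ} (h : Exec p s s' t) (emb : Label p → L) (exit : L)
    (hM : ∀ l, M (emb l) = stmt p emb exit l) :
    StepsWithin (TM2.step M) (s.toCfg (some (emb (entry p)))) (s'.toCfg (some exit)) t := by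
  induction h generalizing exit with
  | write f s =>
    exact .single ((step_toCfg (hM ()) s).trans
      (congrArg (fun S => some (TM2.Cfg.mk _ _ S)) (s.update_stk_out _)))
  | read f s =>
    exact .single ((step_toCfg (hM ()) s).trans
      (congrArg (fun S => some (TM2.Cfg.mk _ _ S)) (s.update_stk_inp _)))
  | load f s => exact .single (step_toCfg (hM ()) s)
  | inc c s =>
    exact .single ((step_toCfg (hM ()) s).trans
      (congrArg (fun S => some (TM2.Cfg.mk _ _ S)) (s.update_stk_ctr c (s.ctr c + 1))))
  | @seq p q _ _ _ _ _ _ _ ihp ihq =>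
    exact (ihp _ (emb (Sum.inr (entry q))) fun l => hM (Sum.inl l)).trans
      (ihq _ exit fun l => hM (Sum.inr l))
  | @ite_true b p q s _ _ hb _ ih =>
    refine (StepsWithin.trans (.single ?_) (ih _ exit fun l => hM (some (Sum.inl l)))).mono
      (Nat.add_comm _ _).le
    refine (step_toCfg (hM none) s).trans ?_
    simp [stmt, toCfg, hb]
  | @ite_false b p q s _ _ hb _ ih =>
    refine (StepsWithin.trans (.single ?_) (ih _ exit fun l => hM (some (Sum.inr l)))).mono
      (Nat.add_comm _ _).le
    refine (step_toCfg (hM none) s).trans ?_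
    simp [stmt, toCfg, hb]
  | @whileInp_done b p s hb =>
    refine .single ((step_toCfg (hM none) s).trans ?_)
    simp only [stmt, stepAux_testInp, hb, cond_false]
  | @whileInp_step b p s _ _ _ _ hb _ _ ihp ih =>
    refine (StepsWithin.trans (.single ?_) ((ihp _ (emb (none : Option _))
      fun l => hM (some l)).trans (ih emb exit hM))).mono (Nat.add_comm _ _).le
    refine (step_toCfg (hM none) s).trans ?_
    simp only [stmt, stepAux_testInp, hb, cond_true]
  | whileCtr_done hc =>
    exact .single ((step_toCfg (hM none) _).trans (congrArg some (stepAux_testCtr_zero hc _ _)))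
  | whileCtr_step hc _ _ ihp ih =>
    exact (StepsWithin.trans
      (.single ((step_toCfg (hM none) _).trans (congrArg some (stepAux_testCtr_succ hc _ _))))
      ((ihp _ (emb (none : Option _)) fun l => hM (some l)).trans (ih emb exit hM))).mono
      (Nat.add_comm _ _).le
  | mono _ hle ih => exact (ih emb exit hM).mono hle

theorem State.stk_empty (r : R) : (⟨r, [], [], fun _ => 0⟩ : State A B C R).stk = fun _ => [] := by
  funext k
  rcases k with _ | _ | k <;> rfl

section Machine

variable [DecidableEq C]

/-- The machine for a program, whose register initially holds `r`. -/
noncomputable abbrev machine [Fintype A] [Fintype C] [Fintype R] (p : CounterProgram A B C R)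
    (r : R) : FinTM2 where
  K := Option (Option C)
  k₀ := none
  k₁ := some none
  Γ := Symbol A B C
  Λ := Option (Label p)
  main := some (entry p)
  ΛFin := Fintype.ofFinite _
  σ := R × Bool
  initialState := (r, false)
  Γk₀Fin := ‹Fintype A›
  m := fun l => l.elim .halt (stmt p some none)

variable [Fintype A] [Fintype C] [Fintype R] (p : CounterProgram A B C R) (r : R)

theorem initList_machine (w : List A) :
    initList (p.machine r) w =
      (⟨r, w, [], fun _ => 0⟩ : State A B C R).toCfg (some (p.machine r).main) := by
  refine congrArg (TM2.Cfg.mk _ _) ((stk_initList _ _).trans ?_)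
  rw [← stk_empty r]
  exact update_stk_inp _ w

theorem haltList_machine (w : List B) :
    haltList (p.machine r) w =
      (⟨r, [], w, fun _ => 0⟩ : State A B C R).toCfg (none : Option (p.machine r).Λ) := by
  refine congrArg (TM2.Cfg.mk _ _) ((stk_haltList _ _).trans ?_)
  rw [← stk_empty r]
  exact update_stk_out _ w

theorem Exec.stepsWithin_machine {p : CounterProgram A B C R} {r : R} {u : List A} {w : List B}
    {t : ℕ} (h : Exec p ⟨r, u, [], fun _ => 0⟩ ⟨r, [], w, fun _ => 0⟩ t) :
    StepsWithin (p.machine r).step (initList (p.machine r) u) (haltList (p.machine r) w)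
      (t + 1) := by
  rw [initList_machine, haltList_machine]
  exact (h.stepsWithin (M := (p.machine r).m) some none fun _ => rfl).tail rfl

end Machine

theorem polyTimeComputable [DecidableEq C] [Finite A] [Finite C] [Finite R] {α β : Type}
    {ea : α → List A} {eb : β → List B} {f : α → β} (p : CounterProgram A B C R) (r : R)
    (time : Polynomial ℕ)
    (h : ∀ a, Exec p ⟨r, ea a, [], fun _ => 0⟩ ⟨r, [], eb (f a), fun _ => 0⟩
      (time.eval (ea a).length)) :
    PolyTimeComputable ea eb f := by
  cases nonempty_fintype A
  cases nonempty_fintype C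
  cases nonempty_fintype R
  have run (a : α) := (h a).stepsWithin_machine.nonempty_evalsToInTime
  refine ⟨⟨⟨p.machine r, Equiv.refl _, Equiv.refl _⟩, time + 1, fun a => ?_⟩⟩
  simpa [TM2OutputsInTime] using! (run a).some

end CounterProgram
/-! ### The cubic polynomial of a circuit -/

/-- The first wire read by a gate. -/
def BoolGate.firstInput : BoolGate → ℕ
  | .and i _ => i
  | .or i _ => i
  | .not i => i

theorem BoolGate.firstInput_mem_inputs (g : BoolGate) : g.firstInput ∈ g.inputs := by
  cases g <;> simp [firstInput, inputs]

namespace BoolCircuit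

/-- The monomials of the polynomial for the output of a gate. The variable `4 * k` stands for its
first input, and the variable `4 * j + 5` for the wire `j`. -/
def gateValueMonomials (k : ℕ) : BoolGate → List (List ℕ)
  | .and _ j => [[4 * j + 5, 4 * k]]
  | .or _ j => [[4 * j + 5, 4 * k], [4 * k], [4 * j + 5]]
  | .not _ => [[4 * k], []]

/-- The monomials for the gate whose output is the wire `k - 1`. The wire `i` has the block of
variables `4 * (i + 1) + c`: for `c = 1` its value, for `c = 0` a copy of the first input of the
gate, for `c = 2` and `c = 3` the multipliers of the equations for the copy and for the value. -/
def gateMonomials (k : ℕ) (g : BoolGate) : List (List ℕ) :=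
  [[4 * g.firstInput + 5, 4 * k + 2], [4 * k, 4 * k + 2], [4 * k + 1, 4 * k + 3]] ++
    (gateValueMonomials k g).map (· ++ [4 * k + 3])

/-- The monomials for a list of gates, whose first output is the wire `k - 1`. They are listed in
reverse order because machines write their output from its last letter to its first. -/
def gatesMonomials : ℕ → List BoolGate → List (List ℕ)
  | _, [] => []
  | k, g :: gs => gatesMonomials (k + 1) gs ++ gateMonomials k g

/-- The monomials for the input wire `k - 1`: it is `0` unless the variable `0` is `1`. -/
def inputMonomials (k : ℕ) : List (List ℕ) :=
  [[4 * k, 4 * k + 2], [0, 4 * k + 1, 4 * k + 3], [4 * k + 1, 4 * k + 3]]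

/-- The monomials for `n` input wires, the first of which is the wire `k - 1`. -/
def inputsMonomials : ℕ → ℕ → List (List ℕ)
  | _, 0 => []
  | k, n + 1 => inputsMonomials (k + 1) n ++ inputMonomials k

/-- The monomials of the polynomial of a circuit that do not depend on the circuit. They use the
variables of the block `0`. -/
def baseMonomials : List (List ℕ) := [[0, 2], [0, 1, 3], [1, 3]]

/-- All monomials of the polynomial of a circuit. -/
def natMonomials (C : BoolCircuit) : List (List ℕ) :=
  gatesMonomials (C.numInputs + 1) C.gates ++
    [0, 2, 4 * C.out + 5] :: (inputsMonomials 1 C.numInputs ++ baseMonomials)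

/-- The number of variables of the polynomial of a circuit. -/
def polyVars (C : BoolCircuit) : ℕ := 4 * (C.numInputs + C.gates.length + 1)

/-- The gates of a list are well-formed when the output of the first one is the wire `w`. -/
def GatesWf (w : ℕ) (gs : List BoolGate) : Prop :=
  ∀ (k : ℕ) (hk : k < gs.length), ∀ i ∈ (gs[k]).inputs, i < w + k

theorem GatesWf.head {w : ℕ} {g : BoolGate} {gs : List BoolGate} (h : GatesWf w (g :: gs)) :
    ∀ i ∈ g.inputs, i < w := h 0 (by simp)

theorem GatesWf.tail {w : ℕ} {g : BoolGate} {gs : List BoolGate} (h : GatesWf w (g :: gs)) :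
    GatesWf (w + 1) gs := fun k hk i hi => by
  have := h (k + 1) (by simpa using hk) i (by simpa using hi)
  omega

/-- A monomial that belongs to the blocks from `a` to `b - 1`: its last variable is a multiplier
of one of these blocks. -/
structure IsBlockMonomial (a b : ℕ) (m : List ℕ) : Prop where
  pairwise : m.Pairwise (· < ·)
  length_le : m.length ≤ 3
  lt : ∀ i ∈ m, i < 4 * b
  exists_multiplier : ∃ l ∈ m, 4 * a ≤ l ∧ 2 ≤ l % 4 ∧ ∀ i ∈ m, i ≤ l

theorem IsBlockMonomial.mono {a b a' b' : ℕ} {m : List ℕ} (h : IsBlockMonomial a b m)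
    (ha : a' ≤ a) (hb : b ≤ b') : IsBlockMonomial a' b' m := by
  obtain ⟨l, hl, hal, hmul, hmax⟩ := h.exists_multiplier
  exact ⟨h.pairwise, h.length_le, fun i hi => (h.lt i hi).trans_le (by omega), l, hl, by omega,
    hmul, hmax⟩

theorem disjoint_of_isBlockMonomial {a b c : ℕ} {l l' : List (List ℕ)}
    (h : ∀ m ∈ l, IsBlockMonomial b c m) (h' : ∀ m ∈ l', IsBlockMonomial a b m) :
    l.Disjoint l' := by
  intro m hm hm'
  obtain ⟨i, hi, hbi, -⟩ := (h m hm).exists_multiplier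
  have := (h' m hm').lt i hi
  omega

theorem isBlockMonomial_append_singleton {k l : ℕ} {m : List ℕ} (hm : m.Pairwise (· < ·))
    (hlen : m.length ≤ 2) (hlt : ∀ i ∈ m, i < l) (hl : l = 4 * k + 2 ∨ l = 4 * k + 3) :
    IsBlockMonomial k (k + 1) (m ++ [l]) where
  pairwise := by simpa [List.pairwise_append, hm] using hlt
  length_le := by simpa [Nat.lt_succ_iff] using hlen
  lt := by
    simp only [List.mem_append, List.mem_singleton, or_imp, forall_and, forall_eq]
    exact ⟨fun i hi => (hlt i hi).trans_le (by omega), by omega⟩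
  exists_multiplier := by
    refine ⟨l, by simp, by omega, by omega, ?_⟩
    simpa [or_imp, forall_and] using fun i hi => (hlt i hi).le

theorem isBlockMonomial_gateMonomials {k : ℕ} {g : BoolGate} (h : ∀ i ∈ g.inputs, i + 1 < k) :
    ∀ m ∈ gateMonomials k g, IsBlockMonomial k (k + 1) m := by
  have copy_eq : ∀ i, i < 4 * k + 2 → IsBlockMonomial k (k + 1) [i, 4 * k + 2] := fun i hi =>
    isBlockMonomial_append_singleton (m := [i]) (by simp) (by simp) (by simpa) (.inl rfl)
  have value_eq : IsBlockMonomial k (k + 1) [4 * k + 1, 4 * k + 3] :=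
    isBlockMonomial_append_singleton (m := [4 * k + 1]) (by simp) (by simp) (by simp) (.inr rfl)
  have hi := h _ g.firstInput_mem_inputs
  simp only [gateMonomials, List.cons_append, List.nil_append, List.mem_cons, List.mem_map]
  rintro m (rfl | rfl | rfl | ⟨m, hm, rfl⟩)
  · exact copy_eq _ (by omega)
  · exact copy_eq _ (by omega)
  · exact value_eq
  · refine isBlockMonomial_append_singleton ?_ ?_ ?_ (.inr rfl) <;>
      cases g <;> simp only [gateValueMonomials, BoolGate.inputs, List.mem_cons, List.not_mem_nil,
        or_false, forall_eq_or_imp, forall_eq] at h hm <;>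
      rcases hm with rfl | rfl | rfl <;> simp <;> omega

theorem nodup_gateMonomials {k : ℕ} {g : BoolGate} (h : ∀ i ∈ g.inputs, i + 1 < k) :
    (gateMonomials k g).Nodup := by
  cases g <;> simp only [BoolGate.inputs, List.mem_cons, List.not_mem_nil, or_false,
      forall_eq_or_imp, forall_eq] at h <;>
    simp [gateMonomials, gateValueMonomials, BoolGate.firstInput] <;> omega

theorem isBlockMonomial_inputMonomials (k : ℕ) :
    ∀ m ∈ inputMonomials k, IsBlockMonomial k (k + 1) m := by
  simp only [inputMonomials, List.mem_cons, List.not_mem_nil, or_false, forall_eq_or_imp,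
    forall_eq]
  exact ⟨isBlockMonomial_append_singleton (m := [4 * k]) (by simp) (by simp) (by simp) (.inl rfl),
    isBlockMonomial_append_singleton (m := [0, 4 * k + 1]) (by simp) (by simp) (by simp) (.inr rfl),
    isBlockMonomial_append_singleton (m := [4 * k + 1]) (by simp) (by simp) (by simp) (.inr rfl)⟩

theorem isBlockMonomial_baseMonomials : ∀ m ∈ baseMonomials, IsBlockMonomial 0 1 m := by
  simp only [baseMonomials, List.mem_cons, List.not_mem_nil, or_false, forall_eq_or_imp, forall_eq]
  exact ⟨isBlockMonomial_append_singleton (m := [0]) (by simp) (by simp) (by simp) (.inl rfl),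
    isBlockMonomial_append_singleton (m := [0, 1]) (by simp) (by simp) (by simp) (.inr rfl),
    isBlockMonomial_append_singleton (m := [1]) (by simp) (by simp) (by simp) (.inr rfl)⟩

theorem isBlockMonomial_gatesMonomials {w : ℕ} {gs : List BoolGate} (h : GatesWf w gs) :
    ∀ m ∈ gatesMonomials (w + 1) gs, IsBlockMonomial (w + 1) (w + 1 + gs.length) m := by
  induction gs generalizing w with
  | nil => simp [gatesMonomials]
  | cons g gs ih =>
    intro m hm
    rw [gatesMonomials, List.mem_append] at hm
    rcases hm with hm | hm
    · exact (ih h.tail m hm).mono (by omega) (by grind)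
    · exact (isBlockMonomial_gateMonomials (fun i hi => Nat.succ_lt_succ (h.head i hi)) m hm).mono
        le_rfl (by simp)

theorem nodup_gatesMonomials {w : ℕ} {gs : List BoolGate} (h : GatesWf w gs) :
    (gatesMonomials (w + 1) gs).Nodup := by
  induction gs generalizing w with
  | nil => simp [gatesMonomials]
  | cons g gs ih =>
    have hg : ∀ i ∈ g.inputs, i + 1 < w + 1 := fun i hi => Nat.succ_lt_succ (h.head i hi)
    exact (ih h.tail).append (nodup_gateMonomials hg) (disjoint_of_isBlockMonomial
      (isBlockMonomial_gatesMonomials h.tail) (isBlockMonomial_gateMonomials hg))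

theorem isBlockMonomial_inputsMonomials (k n : ℕ) :
    ∀ m ∈ inputsMonomials k n, IsBlockMonomial k (k + n) m := by
  induction n generalizing k with
  | zero => simp [inputsMonomials]
  | succ n ih =>
    intro m hm
    rw [inputsMonomials, List.mem_append] at hm
    rcases hm with hm | hm
    · exact (ih (k + 1) m hm).mono (by omega) (by omega)
    · exact (isBlockMonomial_inputMonomials k m hm).mono le_rfl (by omega)

theorem nodup_inputsMonomials (k n : ℕ) : (inputsMonomials k n).Nodup := by
  induction n generalizing k with
  | zero => simp [inputsMonomials]
  | succ n ih =>
    exact (ih (k + 1)).append (by simp [inputMonomials]) (disjoint_of_isBlockMonomial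
      (isBlockMonomial_inputsMonomials (k + 1) n) (isBlockMonomial_inputMonomials k))

theorem isBlockMonomial_inputsMonomials_append_baseMonomials (n : ℕ) :
    ∀ m ∈ inputsMonomials 1 n ++ baseMonomials, IsBlockMonomial 0 (n + 1) m := by
  intro m hm
  rcases List.mem_append.1 hm with hm | hm
  · exact (isBlockMonomial_inputsMonomials 1 n m hm).mono (by omega) (by omega)
  · exact (isBlockMonomial_baseMonomials m hm).mono le_rfl (by omega)

theorem isBlockMonomial_or_eq_of_mem_natMonomials (C : BoolCircuit) :
    ∀ m ∈ C.natMonomials, IsBlockMonomial 0 (C.numInputs + C.gates.length + 1) m ∨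
      m = [0, 2, 4 * C.out + 5] := by
  intro m hm
  simp only [natMonomials, List.mem_append (t := _ :: _), List.mem_cons] at hm
  rcases hm with hm | rfl | hm
  · exact .inl ((isBlockMonomial_gatesMonomials C.gates_wf m hm).mono (by omega) (by omega))
  · exact .inr rfl
  · exact .inl ((isBlockMonomial_inputsMonomials_append_baseMonomials _ m hm).mono le_rfl
      (by omega))

theorem not_isBlockMonomial_output (o a b : ℕ) : ¬ IsBlockMonomial a b [0, 2, 4 * o + 5] := by
  rintro ⟨-, -, -, l, hl, -, hmul, hmax⟩
  simp only [List.mem_cons, List.not_mem_nil, or_false, forall_eq_or_imp, forall_eq] at hl hmax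
  omega

theorem nodup_natMonomials (C : BoolCircuit) : C.natMonomials.Nodup := by
  have hgates := isBlockMonomial_gatesMonomials C.gates_wf
  have hrest := isBlockMonomial_inputsMonomials_append_baseMonomials C.numInputs
  refine (nodup_gatesMonomials C.gates_wf).append (List.nodup_cons.2 ⟨?_, ?_⟩)
    (List.disjoint_cons_right.2 ⟨?_, disjoint_of_isBlockMonomial hgates hrest⟩)
  · exact fun h => not_isBlockMonomial_output _ _ _ (hrest _ h)
  · exact (nodup_inputsMonomials 1 _).append (by simp [baseMonomials]) (disjoint_of_isBlockMonomial
      (isBlockMonomial_inputsMonomials 1 _) isBlockMonomial_baseMonomials)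
  · exact fun h => not_isBlockMonomial_output _ _ _ (hgates _ h)

theorem pairwise_of_mem_natMonomials (C : BoolCircuit) :
    ∀ m ∈ C.natMonomials, m.Pairwise (· < ·) := by
  intro m hm
  rcases C.isBlockMonomial_or_eq_of_mem_natMonomials m hm with h | rfl
  · exact h.pairwise
  · simp

theorem length_le_of_mem_natMonomials (C : BoolCircuit) : ∀ m ∈ C.natMonomials, m.length ≤ 3 := by
  intro m hm
  rcases C.isBlockMonomial_or_eq_of_mem_natMonomials m hm with h | rfl
  · exact h.length_le
  · simp

theorem lt_polyVars_of_mem_natMonomials (C : BoolCircuit) :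
    ∀ m ∈ C.natMonomials, ∀ i ∈ m, i < C.polyVars := by
  intro m hm
  rcases C.isBlockMonomial_or_eq_of_mem_natMonomials m hm with h | rfl
  · exact h.lt
  · have := C.out_wf
    simp only [polyVars, List.mem_cons, List.not_mem_nil, or_false, forall_eq_or_imp, forall_eq]
    omega

instance (C : BoolCircuit) : NeZero C.polyVars := ⟨by simp [polyVars]⟩

theorem map_val_map_ofNat_of_mem_natMonomials (C : BoolCircuit) {m : List ℕ}
    (hm : m ∈ C.natMonomials) : (m.map (Fin.ofNat C.polyVars)).map Fin.val = m := by
  rw [List.map_map]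
  exact (List.map_congr_left fun i hi =>
    Nat.mod_eq_of_lt (C.lt_polyVars_of_mem_natMonomials m hm i hi)).trans m.map_id

/-- The polynomial of a circuit. -/
def toF2Poly (C : BoolCircuit) : F2Poly where
  numVars := C.polyVars
  monomials := C.natMonomials.map (·.map (Fin.ofNat C.polyVars))
  increasing := by
    simp only [List.forall_mem_map]
    intro m hm
    have h := C.pairwise_of_mem_natMonomials m hm
    rwa [← C.map_val_map_ofNat_of_mem_natMonomials hm, List.pairwise_map] at h
  nodup := C.nodup_natMonomials.map_on fun m hm m' hm' h => by
    rw [← C.map_val_map_ofNat_of_mem_natMonomials hm, h,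
      C.map_val_map_ofNat_of_mem_natMonomials hm']

end BoolCircuit

theorem prod_map_X_eq_monomial {σ R : Type*} [DecidableEq σ] [CommSemiring R] (m : List σ) :
    (m.map (MvPolynomial.X (R := R))).prod =
      MvPolynomial.monomial (Multiset.toFinsupp (m : Multiset σ)) 1 := by
  induction m with
  | nil => simp
  | cons i m ih =>
    rw [List.map_cons, List.prod_cons, ih, MvPolynomial.X, MvPolynomial.monomial_mul, one_mul,
      ← Multiset.cons_coe, ← Multiset.singleton_add, map_add, Multiset.toFinsupp_singleton]

namespace F2Poly

open MvPolynomial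

theorem toMvPolynomial_eq_sum (p : F2Poly) :
    p.toMvPolynomial = ∑ m ∈ p.monomials.toFinset,
      monomial (Multiset.toFinsupp (m : Multiset (Fin p.numVars))) 1 := by
  rw [List.sum_toFinset _ p.nodup, toMvPolynomial]
  simp only [prod_map_X_eq_monomial]

theorem coeff_toMvPolynomial_of_mem (p : F2Poly) {m : List (Fin p.numVars)}
    (hm : m ∈ p.monomials) :
    coeff (Multiset.toFinsupp (m : Multiset (Fin p.numVars))) p.toMvPolynomial = 1 := by
  rw [toMvPolynomial_eq_sum, coeff_sum, Finset.sum_eq_single_of_mem m (List.mem_toFinset.2 hm)]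
  · rw [coeff_monomial, if_pos rfl]
  · intro m' hm' hne
    rw [coeff_monomial, if_neg]
    rw [EmbeddingLike.apply_eq_iff_eq, Multiset.coe_eq_coe]
    exact fun h => hne (h.eq_of_pairwise (fun _ _ _ _ h₁ h₂ => absurd h₁ h₂.asymm)
      (p.increasing m' (List.mem_toFinset.1 hm')) (p.increasing m hm))

theorem totalDegree_toMvPolynomial_eq (p : F2Poly) {d : ℕ}
    (hle : ∀ m ∈ p.monomials, m.length ≤ d) (hex : ∃ m ∈ p.monomials, m.length = d) :
    p.toMvPolynomial.totalDegree = d := by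
  have degree_eq (m : List (Fin p.numVars)) :
      ((Multiset.toFinsupp (m : Multiset (Fin p.numVars))).sum fun _ e => e) = m.length :=
    Multiset.toFinsupp_sum_eq _
  refine le_antisymm ?_ ?_
  · rw [toMvPolynomial_eq_sum]
    refine totalDegree_finsetSum_le fun m hm => (totalDegree_monomial_le _ _).trans ?_
    exact (degree_eq m).trans_le (hle m (List.mem_toFinset.1 hm))
  · obtain ⟨m, hm, rfl⟩ := hex
    rw [← degree_eq m]
    refine le_totalDegree (mem_support_iff.2 ?_)
    rw [p.coeff_toMvPolynomial_of_mem hm]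
    exact one_ne_zero

end F2Poly

theorem BoolCircuit.totalDegree_toF2Poly (C : BoolCircuit) :
    C.toF2Poly.toMvPolynomial.totalDegree = 3 := by
  refine C.toF2Poly.totalDegree_toMvPolynomial_eq (List.forall_mem_map.2 fun m hm => ?_)
    ⟨[0, 1, 3].map (Fin.ofNat C.polyVars), List.mem_map_of_mem ?_, rfl⟩
  · exact (List.length_map _).trans_le (C.length_le_of_mem_natMonomials m hm)
  · simp [natMonomials, baseMonomials]

/-- The polynomial of a circuit, as a polynomial of degree `3`. -/
def BoolCircuit.toCubic (C : BoolCircuit) : CubicF2Poly := ⟨C.toF2Poly, C.totalDegree_toF2Poly⟩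

/-! ### The gap of the polynomial of a circuit -/

section ListSum

variable {A M R : Type*} [Fintype A]

/-- The sum of a function over all lists of a given length. -/
def listSum [AddCommMonoid M] (n : ℕ) (F : List A → M) : M := ∑ x : Fin n → A, F (List.ofFn x)

theorem listSum_congr [AddCommMonoid M] {n : ℕ} {F G : List A → M}
    (h : ∀ l, l.length = n → F l = G l) : listSum n F = listSum n G :=
  Finset.sum_congr rfl fun _ _ => h _ List.length_ofFn

theorem mul_listSum [NonUnitalNonAssocSemiring R] (n : ℕ) (c : R) (F : List A → R) :
    c * listSum n F = listSum n fun l => c * F l :=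
  Finset.mul_sum _ _ _

theorem listSum_zero [AddCommMonoid M] (F : List A → M) : listSum 0 F = F [] := by
  simp [listSum]

theorem listSum_succ [AddCommMonoid M] (n : ℕ) (F : List A → M) :
    listSum (n + 1) F = ∑ a, listSum n fun l => F (a :: l) := by
  simp only [listSum]
  rw [← Fintype.sum_prod_type' (f := fun a (x : Fin n → A) => F (a :: List.ofFn x)),
    ← (Fin.consEquiv fun _ => A).sum_comp]
  simp [Fin.consEquiv]

theorem listSum_add [AddCommMonoid M] (m n : ℕ) (F : List A → M) :
    listSum (m + n) F = listSum m fun l => listSum n fun r => F (l ++ r) := by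
  induction m generalizing F with
  | zero => simp [listSum_zero]
  | succ m ih =>
    rw [Nat.succ_add]
    simp only [listSum_succ, ih, List.cons_append]

theorem listSum_four_mul_succ [AddCommMonoid M] (n : ℕ) (F : List A → M) :
    listSum (4 * (n + 1)) F = ∑ a, ∑ b, ∑ c, ∑ d,
      listSum (4 * n) fun l => F (a :: b :: c :: d :: l) := by
  simp only [Nat.mul_succ, listSum_succ]

end ListSum

/-- The sign `(-1)^z`. -/
def zmodSign (z : ZMod 2) : ℤ := (-1) ^ z.val

theorem zmodSign_zero : zmodSign 0 = 1 := rfl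

theorem zmodSign_one : zmodSign 1 = -1 := rfl

theorem zmodSign_add (y z : ZMod 2) : zmodSign (y + z) = zmodSign y * zmodSign z := by
  revert y z; decide

theorem sum_zmod_two {M : Type*} [AddCommMonoid M] (F : ZMod 2 → M) : ∑ z, F z = F 0 + F 1 :=
  Fin.sum_univ_two F

theorem sum_zmodSign_mul (z : ZMod 2) : ∑ c, zmodSign (c * z) = if z = 0 then 2 else 0 := by
  revert z; decide

/-- Bits as elements of the field with two elements. -/
def boolZMod : Bool ≃ ZMod 2 where
  toFun b := bif b then 1 else 0
  invFun z := decide (z = 1)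
  left_inv := by decide
  right_inv := by decide

theorem boolZMod_false : boolZMod false = 0 := rfl

theorem zmodSign_boolZMod (b : Bool) : zmodSign (boolZMod b) = 1 - 2 * if b then 1 else 0 := by
  cases b <;> rfl

theorem sum_equations_mul (x : ZMod 2) (p : ZMod 2 → ZMod 2) (T : ZMod 2 → ℤ) :
    ∑ a, ∑ b, ∑ c, ∑ d, zmodSign (c * (x + a) + d * (b + p a)) * T b = 4 * T (p x) := by
  have sum_multipliers (a b : ZMod 2) :
      ∑ c, ∑ d, zmodSign (c * (x + a) + d * (b + p a)) * T b =
        if a = x then if b = p a then 4 * T b else 0 else 0 := by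
    simp only [zmodSign_add, mul_assoc, ← Finset.mul_sum, ← Finset.sum_mul, sum_zmodSign_mul,
      CharTwo.add_eq_zero, eq_comm (a := x)]
    split_ifs <;> ring
  simp only [sum_multipliers, Finset.sum_ite_irrel, Finset.sum_const_zero, Finset.sum_ite_eq',
    Finset.mem_univ, if_true]

theorem sum_input_equations_mul (s : ZMod 2) (T : ZMod 2 → ℤ) :
    ∑ a, ∑ b, ∑ c, ∑ d, zmodSign (a * c + (s * (b * d) + b * d)) * T b =
      4 * if s = 1 then T 0 + T 1 else T 0 := by
  obtain rfl | rfl : s = 0 ∨ s = 1 := by revert s; decide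
  all_goals
    simp [sum_zmod_two, zmodSign_zero, zmodSign_one, CharTwo.add_self_eq_zero]
    ring

/-- The value of a sum of monomials at the point with coordinates `l`. -/
def evalMonomials (l : List (ZMod 2)) (ms : List (List ℕ)) : ZMod 2 :=
  (ms.map fun m => (m.map fun i => l.getD i 0).prod).sum

theorem evalMonomials_append (l : List (ZMod 2)) (ms ms' : List (List ℕ)) :
    evalMonomials l (ms ++ ms') = evalMonomials l ms + evalMonomials l ms' := by
  simp [evalMonomials]

theorem evalMonomials_cons (l : List (ZMod 2)) (m : List ℕ) (ms : List (List ℕ)) :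
    evalMonomials l (m :: ms) = (m.map fun i => l.getD i 0).prod + evalMonomials l ms := by
  simp [evalMonomials]

theorem evalMonomials_map_append_singleton (l : List (ZMod 2)) (ms : List (List ℕ)) (i : ℕ) :
    evalMonomials l (ms.map (· ++ [i])) = evalMonomials l ms * l.getD i 0 := by
  simp [evalMonomials, List.sum_map_mul_right, Function.comp_def]

theorem evalMonomials_append_left (l r : List (ZMod 2)) (ms : List (List ℕ))
    (h : ∀ m ∈ ms, ∀ i ∈ m, i < l.length) : evalMonomials (l ++ r) ms = evalMonomials l ms :=
  congrArg List.sum <| List.map_congr_left fun m hm => congrArg List.prod <|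
    List.map_congr_left fun i hi => List.getD_append _ _ _ _ (h m hm i hi)

namespace BoolGate

/-- The output of a gate as a polynomial in its first input, for given values of the wires. -/
def valueAt (w : List Bool) : BoolGate → ZMod 2 → ZMod 2
  | .and _ j, a => boolZMod (w.getD j false) * a
  | .or _ j, a => boolZMod (w.getD j false) * a + (a + boolZMod (w.getD j false))
  | .not _, a => a + 1

theorem valueAt_firstInput (w : List Bool) (g : BoolGate) :
    g.valueAt w (boolZMod (w.getD g.firstInput false)) = boolZMod (g.eval w) := by
  cases g with
  | and i j => exact (by decide : ∀ a b, boolZMod b * boolZMod a = boolZMod (a && b)) _ _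
  | or i j =>
    exact (by decide : ∀ a b, boolZMod b * boolZMod a + (boolZMod a + boolZMod b) =
      boolZMod (a || b)) _ _
  | not i => exact (by decide : ∀ a, boolZMod a + 1 = boolZMod !a) _

end BoolGate

/-- The list `l` of values of variables contains the list `w` of values of wires. -/
structure EncodesWires (l : List (ZMod 2)) (w : List Bool) : Prop where
  length_eq : l.length = 4 * (w.length + 1)
  getD_eq : ∀ i, l.getD (4 * i + 5) 0 = boolZMod (w.getD i false)

/-- The values of all wires, starting with the values of the wires before the first gate. -/
def BoolCircuit.runGates (gs : List BoolGate) (w : List Bool) : List Bool :=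
  gs.foldl (fun w g => w ++ [g.eval w]) w

namespace EncodesWires

open BoolCircuit

variable {l : List (ZMod 2)} {w : List Bool} (h : EncodesWires l w)

include h

theorem append_block (a b c d : ZMod 2) :
    EncodesWires (l ++ [a, b, c, d]) (w ++ [boolZMod.symm b]) := by
  have hl := h.length_eq
  have hl' : (l ++ [a, b, c, d]).length = l.length + 4 := by simp
  have hw' : (w ++ [boolZMod.symm b]).length = w.length + 1 := by simp
  refine ⟨by omega, fun i => ?_⟩
  rcases lt_trichotomy i w.length with hi | rfl | hi
  · rw [List.getD_append _ _ _ _ (by omega), List.getD_append _ _ _ _ hi, h.getD_eq]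
  · rw [List.getD_append_right _ _ _ _ (by omega), List.getD_append_right _ _ _ _ le_rfl,
      show 4 * w.length + 5 - l.length = 1 by omega]
    simp
  · rw [List.getD_eq_default _ _ (by omega), List.getD_eq_default _ _ (by omega), boolZMod_false]

theorem getD_block (r : List (ZMod 2)) (i : ℕ) :
    (l ++ r).getD (4 * (w.length + 1) + i) 0 = r.getD i 0 := by
  rw [← h.length_eq, List.getD_append_right _ _ _ _ (Nat.le_add_right _ _),
    Nat.add_sub_cancel_left]

theorem getD_block_zero (r : List (ZMod 2)) :
    (l ++ r).getD (4 * (w.length + 1)) 0 = r.getD 0 0 :=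
  h.getD_block r 0

theorem getD_wire (r : List (ZMod 2)) {i : ℕ} (hi : i < w.length) :
    (l ++ r).getD (4 * i + 5) 0 = boolZMod (w.getD i false) := by
  rw [List.getD_append _ _ _ _ (by have := h.length_eq; omega), h.getD_eq]

theorem getD_zero (r : List (ZMod 2)) : (l ++ r).getD 0 0 = l.getD 0 0 :=
  List.getD_append _ _ _ _ (by have := h.length_eq; omega)

theorem evalMonomials_gateValueMonomials {g : BoolGate} (hg : ∀ i ∈ g.inputs, i < w.length)
    (a : ZMod 2) (r : List (ZMod 2)) :
    evalMonomials (l ++ a :: r) (gateValueMonomials (w.length + 1) g) = g.valueAt w a := by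
  have copy_eq : (l ++ a :: r).getD (4 * (w.length + 1)) 0 = a := h.getD_block _ 0
  have wire_eq : ∀ i ∈ g.inputs, (l ++ a :: r).getD (4 * i + 5) 0 = boolZMod (w.getD i false) :=
    fun i hi => h.getD_wire _ (hg i hi)
  cases g with
  | and _ j =>
    simp only [gateValueMonomials, evalMonomials_cons, List.map_cons, List.map_nil, List.prod_cons,
      List.prod_nil, copy_eq, wire_eq j (by simp [BoolGate.inputs]), BoolGate.valueAt]
    simp [evalMonomials]
  | or _ j =>
    simp only [gateValueMonomials, evalMonomials_cons, List.map_cons, List.map_nil, List.prod_cons,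
      List.prod_nil, copy_eq, wire_eq j (by simp [BoolGate.inputs]), BoolGate.valueAt]
    simp [evalMonomials]
  | not _ =>
    simp only [gateValueMonomials, evalMonomials_cons, List.map_cons, List.map_nil, List.prod_cons,
      List.prod_nil, copy_eq, BoolGate.valueAt]
    simp [evalMonomials]

theorem evalMonomials_gateMonomials {g : BoolGate} (hg : ∀ i ∈ g.inputs, i < w.length)
    (a b c d : ZMod 2) (r : List (ZMod 2)) :
    evalMonomials (l ++ a :: b :: c :: d :: r) (gateMonomials (w.length + 1) g) =
      c * (boolZMod (w.getD g.firstInput false) + a) + d * (b + g.valueAt w a) := by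
  rw [gateMonomials, evalMonomials_append, evalMonomials_map_append_singleton,
    h.evalMonomials_gateValueMonomials hg]
  simp only [evalMonomials, List.map_cons, List.map_nil, List.prod_cons, List.prod_nil,
    List.sum_cons, List.sum_nil, h.getD_block_zero, h.getD_block,
    h.getD_wire _ (hg _ g.firstInput_mem_inputs), List.getD_cons_zero, List.getD_cons_succ]
  ring

theorem evalMonomials_inputMonomials (a b c d : ZMod 2) (r : List (ZMod 2)) :
    evalMonomials (l ++ a :: b :: c :: d :: r) (inputMonomials (w.length + 1)) =
      a * c + (l.getD 0 0 * (b * d) + b * d) := by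
  simp only [evalMonomials, inputMonomials, List.map_cons, List.map_nil, List.prod_cons,
    List.prod_nil, List.sum_cons, List.sum_nil, h.getD_zero, h.getD_block_zero, h.getD_block,
    List.getD_cons_zero, List.getD_cons_succ]
  ring

theorem listSum_gateMonomials {g : BoolGate} (hg : ∀ i ∈ g.inputs, i < w.length) (n : ℕ)
    (F : List (ZMod 2) → ℤ) (T : Bool → ℤ)
    (hF : ∀ a b c d, listSum (4 * n) (fun r => F (l ++ a :: b :: c :: d :: r)) =
      T (boolZMod.symm b)) :
    listSum (4 * (n + 1)) (fun r =>
      zmodSign (evalMonomials (l ++ r) (gateMonomials (w.length + 1) g)) * F (l ++ r)) =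
      4 * T (g.eval w) := by
  rw [listSum_four_mul_succ]
  simp only [h.evalMonomials_gateMonomials hg, ← mul_listSum, hF]
  refine (sum_equations_mul _ _ fun b => T (boolZMod.symm b)).trans ?_
  rw [g.valueAt_firstInput, Equiv.symm_apply_apply]

theorem listSum_inputMonomials (n : ℕ) (F : List (ZMod 2) → ℤ) (T : Bool → ℤ)
    (hF : ∀ a b c d, listSum (4 * n) (fun r => F (l ++ a :: b :: c :: d :: r)) =
      T (boolZMod.symm b)) :
    listSum (4 * (n + 1)) (fun r =>
      zmodSign (evalMonomials (l ++ r) (inputMonomials (w.length + 1))) * F (l ++ r)) =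
      4 * if l.getD 0 0 = 1 then T true + T false else T false := by
  rw [listSum_four_mul_succ]
  simp only [h.evalMonomials_inputMonomials, ← mul_listSum, hF]
  rw [sum_input_equations_mul _ fun b => T (boolZMod.symm b), add_comm]
  rfl

theorem listSum_gatesMonomials {gs : List BoolGate} (hgs : GatesWf w.length gs)
    (F : List (ZMod 2) → ℤ) (T : List Bool → ℤ) (hF : ∀ l w, EncodesWires l w → F l = T w) :
    listSum (4 * gs.length) (fun r =>
      zmodSign (evalMonomials (l ++ r) (gatesMonomials (w.length + 1) gs)) * F (l ++ r)) =
      4 ^ gs.length * T (runGates gs w) := by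
  induction gs generalizing l w with
  | nil => simp [listSum_zero, gatesMonomials, evalMonomials, zmodSign_zero, runGates, hF l w h]
  | cons g gs ih =>
    simp only [gatesMonomials, evalMonomials_append, zmodSign_add, List.length_cons]
    simp only [mul_comm (zmodSign (evalMonomials _ (gatesMonomials _ _))), mul_assoc]
    rw [h.listSum_gateMonomials hgs.head gs.length
      (fun l' => F l' * zmodSign (evalMonomials l' (gatesMonomials (w.length + 1 + 1) gs)))
      (fun b => 4 ^ gs.length * T (runGates gs (w ++ [b])))]
    · rw [pow_succ', mul_assoc]
      rfl
    · intro a b c d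
      simpa [mul_comm (F _)] using ih (h.append_block a b c d) (by simpa using hgs.tail)

theorem listSum_inputsMonomials {n N : ℕ} (hN : w.length + n = N) (F : List (ZMod 2) → ℤ)
    (T : List Bool → ℤ) (hF : ∀ l w, EncodesWires l w → w.length = N → F l = T w) :
    listSum (4 * n) (fun r =>
      zmodSign (evalMonomials (l ++ r) (inputsMonomials (w.length + 1) n)) * F (l ++ r)) =
      4 ^ n * if l.getD 0 0 = 1 then listSum n (fun x => T (w ++ x))
        else T (w ++ List.replicate n false) := by
  induction n generalizing l w with
  | zero =>
    simp [listSum_zero, inputsMonomials, evalMonomials, zmodSign_zero, hF l w h (by simpa using hN)]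
  | succ n ih =>
    simp only [inputsMonomials, evalMonomials_append, zmodSign_add]
    simp only [mul_comm (zmodSign (evalMonomials _ (inputsMonomials _ _))), mul_assoc]
    rw [h.listSum_inputMonomials n
      (fun l' => F l' * zmodSign (evalMonomials l' (inputsMonomials (w.length + 1 + 1) n)))
      (fun b => 4 ^ n * if l.getD 0 0 = 1 then listSum n (fun x => T (w ++ b :: x))
        else T (w ++ b :: List.replicate n false))]
    · rw [pow_succ', mul_assoc, listSum_succ, Fintype.sum_bool, List.replicate_succ]
      split_ifs <;> ring
    · intro a b c d
      have hl := h.getD_zero [a, b, c, d]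
      have := ih (h.append_block a b c d) (by simp; omega)
      simp only [List.length_append, List.length_singleton, List.append_assoc, List.cons_append,
        List.nil_append] at this hl
      rw [hl] at this
      rw [← this]
      simp only [mul_comm (F _)]

end EncodesWires

theorem F2Poly.eval_toMvPolynomial (p : F2Poly) (x : Fin p.numVars → ZMod 2) :
    MvPolynomial.eval x p.toMvPolynomial = (p.monomials.map fun m => (m.map x).prod).sum := by
  simp [toMvPolynomial, map_list_sum, map_list_prod, Function.comp_def]

namespace BoolCircuit

theorem eval_toF2Poly (C : BoolCircuit) (x : Fin C.polyVars → ZMod 2) :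
    MvPolynomial.eval x C.toF2Poly.toMvPolynomial = evalMonomials (List.ofFn x) C.natMonomials := by
  refine (C.toF2Poly.eval_toMvPolynomial x).trans ?_
  simp only [toF2Poly, List.map_map, evalMonomials]
  refine congrArg List.sum (List.map_congr_left fun m hm => congrArg List.prod ?_)
  rw [List.map_map]
  refine List.map_congr_left fun i hi => ?_
  have hi' := C.lt_polyVars_of_mem_natMonomials m hm i hi
  rw [List.getD_eq_getElem _ _ (by simpa using hi'), List.getElem_ofFn]
  exact congrArg x (Fin.ext (Nat.mod_eq_of_lt hi'))

theorem gap_toCubic_eq_listSum (C : BoolCircuit) :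
    C.toCubic.gap = listSum C.polyVars fun l => zmodSign (evalMonomials l C.natMonomials) :=
  Finset.sum_congr rfl fun x _ => congrArg zmodSign (C.eval_toF2Poly x)

/-- The output bit of a circuit for a list of input bits. -/
def evalList (C : BoolCircuit) (x : List Bool) : Bool := (runGates C.gates x).getD C.out false

theorem count_eq_listSum (C : BoolCircuit) :
    (C.count : ℤ) = listSum C.numInputs fun x => if C.evalList x then 1 else 0 := by
  rw [count, Finset.card_filter, Nat.cast_sum]
  simp only [Nat.cast_ite, Nat.cast_one, Nat.cast_zero]
  rfl

theorem listSum_zmodSign_evalList (C : BoolCircuit) :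
    listSum C.numInputs (fun x => zmodSign (boolZMod (C.evalList x))) =
      2 ^ C.numInputs - 2 * C.count := by
  simp only [zmodSign_boolZMod, count_eq_listSum, listSum, Finset.sum_sub_distrib, ← Finset.mul_sum]
  simp

theorem zmodSign_evalMonomials_natMonomials (C : BoolCircuit) (s t y z : ZMod 2)
    {u : List (ZMod 2)} (hu : u.length = 4 * C.numInputs) (v : List (ZMod 2)) :
    zmodSign (evalMonomials ([s, t, y, z] ++ (u ++ v)) C.natMonomials) =
      zmodSign (s * y + (s * t * z + t * z)) *
      (zmodSign (evalMonomials ([s, t, y, z] ++ u) (inputsMonomials 1 C.numInputs)) *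
      (zmodSign (evalMonomials ([s, t, y, z] ++ u ++ v)
        (gatesMonomials (C.numInputs + 1) C.gates)) *
      zmodSign (s * y * ([s, t, y, z] ++ u ++ v).getD (4 * C.out + 5) 0))) := by
  have inputs_eq : evalMonomials ([s, t, y, z] ++ u ++ v) (inputsMonomials 1 C.numInputs) =
      evalMonomials ([s, t, y, z] ++ u) (inputsMonomials 1 C.numInputs) :=
    evalMonomials_append_left _ v _ fun m hm i hi => by
      have := (isBlockMonomial_inputsMonomials 1 _ m hm).lt i hi
      rw [List.length_append, hu]
      exact this.trans_eq (by simp; ring)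
  rw [← List.append_assoc, natMonomials, evalMonomials_append, evalMonomials_cons,
    evalMonomials_append, inputs_eq]
  simp only [← zmodSign_add]
  congr 1
  simp only [baseMonomials, evalMonomials, List.map_cons, List.map_nil, List.prod_cons,
    List.prod_nil, List.sum_cons, List.sum_nil, List.cons_append, List.nil_append,
    List.getD_cons_zero, List.getD_cons_succ]
  ring

theorem listSum_natMonomials (C : BoolCircuit) (s t y z : ZMod 2) :
    listSum (4 * C.numInputs + 4 * C.gates.length) (fun l =>
      zmodSign (evalMonomials (s :: t :: y :: z :: l) C.natMonomials)) =
      zmodSign (s * y + (s * t * z + t * z)) * (4 ^ (C.numInputs + C.gates.length) *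
        if s = 1 then listSum C.numInputs (fun x => zmodSign (s * y * boolZMod (C.evalList x)))
        else zmodSign (s * y * boolZMod (C.evalList (List.replicate C.numInputs false)))) := by
  have hbase : EncodesWires [s, t, y, z] [] := ⟨rfl, fun i => by simp [boolZMod_false]⟩
  let T (w : List Bool) : ℤ := 4 ^ C.gates.length * zmodSign (s * y * boolZMod (C.evalList w))
  let F (l : List (ZMod 2)) : ℤ := listSum (4 * C.gates.length) fun v =>
    zmodSign (evalMonomials (l ++ v) (gatesMonomials (C.numInputs + 1) C.gates)) *
      zmodSign (s * y * (l ++ v).getD (4 * C.out + 5) 0)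
  have sum_gates (l : List (ZMod 2)) (w : List Bool) (h : EncodesWires l w)
      (hw : w.length = C.numInputs) : F l = T w := by
    have hgates : GatesWf w.length C.gates := hw ▸ C.gates_wf
    simp only [F, ← hw]
    exact h.listSum_gatesMonomials hgates (fun l => zmodSign (s * y * l.getD (4 * C.out + 5) 0))
      (fun w => zmodSign (s * y * boolZMod (w.getD C.out false))) fun l w h => by rw [h.getD_eq]
  have sum_inputs :=
    hbase.listSum_inputsMonomials (n := C.numInputs) (Nat.zero_add _) F T sum_gates
  calc
    _ = zmodSign (s * y + (s * t * z + t * z)) * listSum (4 * C.numInputs) (fun u =>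
        zmodSign (evalMonomials ([s, t, y, z] ++ u) (inputsMonomials 1 C.numInputs)) *
          F ([s, t, y, z] ++ u)) := by
      rw [listSum_add]
      simp only [F, mul_listSum]
      exact listSum_congr fun u hu => listSum_congr fun v _ =>
        C.zmodSign_evalMonomials_natMonomials s t y z hu v
    _ = _ := by
      refine (congrArg (_ * ·) sum_inputs).trans ?_
      simp only [T, ← mul_listSum, List.nil_append, List.getD_cons_zero, pow_add]
      split_ifs <;> ring

theorem gap_toCubic (C : BoolCircuit) :
    C.toCubic.gap = 4 ^ (C.numInputs + C.gates.length + 1) * (2 * C.count + 1) := by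
  have hvars : C.polyVars = 4 * (0 + 1) + (4 * C.numInputs + 4 * C.gates.length) := by
    rw [polyVars]
    ring
  rw [gap_toCubic_eq_listSum, hvars, listSum_add, listSum_four_mul_succ]
  simp only [mul_zero, listSum_zero, List.cons_append, List.nil_append, listSum_natMonomials,
    sum_zmod_two]
  have hone : listSum C.numInputs (fun _ : List Bool => (1 : ℤ)) = 2 ^ C.numInputs := by
    simp [listSum]
  simp only [zero_ne_one, if_true, if_false, zero_mul, one_mul, mul_one, add_zero, zero_add,
    CharTwo.add_self_eq_zero, zmodSign_zero, zmodSign_one, listSum_zmodSign_evalList,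
    hone]
  ring

end BoolCircuit

/-! ### Basic programs -/

namespace CounterProgram

variable {A B C R : Type}

/-- The program that does nothing. -/
def skip : CounterProgram A B C R := .load id

/-- Write a symbol a fixed number of times. -/
def writeReplicate (b : B) : ℕ → CounterProgram A B C R
  | 0 => skip
  | n + 1 => .seq (.write fun _ => b) (writeReplicate b n)

/-- Set a counter to zero. -/
def clear (c : C) : CounterProgram A B C R := .whileCtr c skip

/-- Move the counter `c` to the counter `d`, and write `k` times the symbol `b` for each unit. -/
def transfer (c d : C) (b : B) (k : ℕ) : CounterProgram A B C R :=
  .whileCtr c (.seq (.inc d) (writeReplicate b k))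

/-- Remove the first symbols of the input, as long as they satisfy `b`. -/
def skipWhile (b : A → Bool) : CounterProgram A B C R :=
  .whileInp (fun o => o.any b) (.read fun r _ => r)

/-- Remove the symbols `a` from the beginning of the input, and count them in `c`. -/
def countSymbol [DecidableEq A] (a : A) (c : C) : CounterProgram A B C R :=
  .whileInp (fun o => o = some a) (.seq (.read fun r _ => r) (.inc c))

/-- Move the input to the output, replacing each symbol `a` by `f a`. As the output is written from
its last letter to its first, this reverses the word. -/
def mapReverse (f : A → B) (b : B) : CounterProgram A B C (Option A) :=
  .whileInp Option.isSome <|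
    .seq (.read fun _ o => o) <| .seq (.write fun r => r.elim b f) (.load fun _ => none)

variable [DecidableEq C]

/-- In `S n m`, the counter `c` is `n`, and `m` executions of the body are done. -/
theorem Exec.whileCtr_of_forall {c : C} {p : CounterProgram A B C R} {t : ℕ}
    {S : ℕ → ℕ → State A B C R} (hS : ∀ n m, (S n m).ctr c = n)
    (h : ∀ n m, Exec p { S (n + 1) m with ctr := Function.update (S (n + 1) m).ctr c n }
      (S n (m + 1)) t) (n m : ℕ) :
    Exec (.whileCtr c p) (S n m) (S 0 (m + n)) ((t + 1) * n + 1) := by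
  induction n generalizing m with
  | zero => exact .whileCtr_done (hS 0 m)
  | succ n ih =>
    have rest := ih (m + 1)
    rw [Nat.add_right_comm m, Nat.add_assoc m] at rest
    exact (Exec.whileCtr_step (hS _ m) (h n m) rest).mono (by ring_nf; rfl)

/-- In `S x y`, the input starts with `x`, and the symbols of `y` have been read. -/
theorem Exec.whileInp_of_forall {b : Option A → Bool} {p : CounterProgram A B C R} {t : ℕ}
    {inp : List A} {S : List A → List A → State A B C R} (hS : ∀ x y, (S x y).inp = x ++ inp)
    (hinp : b inp.head? = false)
    (h : ∀ a x y, b (some a) = true → Exec p (S (a :: x) y) (S x (a :: y)) t)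
    {x : List A} (hx : ∀ a ∈ x, b (some a) = true) (y : List A) :
    Exec (.whileInp b p) (S x y) (S [] (x.reverse ++ y)) ((t + 1) * x.length + 1) := by
  induction x generalizing y with
  | nil => exact .whileInp_done (by rwa [hS])
  | cons a x ih =>
    rw [List.forall_mem_cons] at hx
    have rest := ih hx.2 (a :: y)
    rw [List.reverse_cons, List.append_assoc, List.singleton_append]
    refine (Exec.whileInp_step (by rw [hS]; exact hx.1) (h a x y hx.1) rest).mono ?_
    rw [List.length_cons]
    ring_nf
    rfl

theorem Exec.skip (s : State A B C R) : Exec skip s s 1 := .load _ s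

variable (r : R) (inp : List A) (out : List B) (ctr : C → ℕ)

theorem Exec.inc_update (c : C) (n : ℕ) :
    Exec (.inc c) ⟨r, inp, out, Function.update ctr c n⟩
      ⟨r, inp, out, Function.update ctr c (n + 1)⟩ 1 := by
  simpa only [Function.update_self, Function.update_idem] using
    Exec.inc c (⟨r, inp, out, Function.update ctr c n⟩ : State A B C R)

theorem Exec.writeReplicate (b : B) (n : ℕ) :
    Exec (writeReplicate b n) ⟨r, inp, out, ctr⟩ ⟨r, inp, List.replicate n b ++ out, ctr⟩
      (n + 1) := by
  induction n generalizing out with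
  | zero => exact .skip _
  | succ n ih =>
    rw [List.replicate_succ', List.append_assoc, List.singleton_append]
    exact (Exec.seq (.write _ _) (ih (b :: out))).mono (by omega)

theorem Exec.clear (c : C) :
    Exec (clear c) ⟨r, inp, out, ctr⟩ ⟨r, inp, out, Function.update ctr c 0⟩
      (2 * ctr c + 1) := by
  have loop := Exec.whileCtr_of_forall (c := c) (p := CounterProgram.skip) (t := 1)
    (S := fun n _ => (⟨r, inp, out, Function.update ctr c n⟩ : State A B C R))
    (fun n _ => Function.update_self c n ctr)
    (fun n _ => by simpa only [Function.update_idem] using Exec.skip _) (ctr c) 0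
  rwa [Function.update_eq_self] at loop

theorem Exec.whileCtr_writeReplicate (c : C) (b : B) (k : ℕ) :
    Exec (.whileCtr c (CounterProgram.writeReplicate b k)) ⟨r, inp, out, ctr⟩
      ⟨r, inp, List.replicate (k * ctr c) b ++ out, Function.update ctr c 0⟩
      ((k + 2) * ctr c + 1) := by
  have loop := Exec.whileCtr_of_forall (c := c) (p := CounterProgram.writeReplicate b k)
    (t := k + 1) (S := fun n m => (⟨r, inp, List.replicate (k * m) b ++ out,
      Function.update ctr c n⟩ : State A B C R))
    (fun n _ => Function.update_self c n ctr)
    (fun n m => by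
      rw [Function.update_idem, Nat.mul_succ, Nat.add_comm (k * m), List.replicate_add,
        List.append_assoc]
      exact .writeReplicate _ _ _ _ b k) (ctr c) 0
  simpa only [Function.update_eq_self, Nat.mul_zero, Nat.zero_add, List.replicate_zero,
    List.nil_append] using loop

theorem Exec.transfer {c d : C} (hcd : c ≠ d) (b : B) (k n m : ℕ) :
    Exec (transfer c d b k) ⟨r, inp, out, Function.update (Function.update ctr c n) d m⟩
      ⟨r, inp, List.replicate (k * n) b ++ out,
        Function.update (Function.update ctr c 0) d (m + n)⟩
      ((k + 3) * n + 1) := by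
  have loop := Exec.whileCtr_of_forall (c := c)
    (p := .seq (.inc d) (CounterProgram.writeReplicate b k))
    (t := 1 + (k + 1)) (S := fun n i => (⟨r, inp, List.replicate (k * i) b ++ out,
      Function.update (Function.update ctr c n) d (m + i)⟩ : State A B C R))
    (fun n i => by simp [hcd])
    (fun n i => by
      dsimp only
      rw [Function.update_comm hcd.symm, Function.update_idem, Nat.mul_succ,
        Nat.add_comm (k * i), List.replicate_add, List.append_assoc]
      exact .seq (.inc_update _ _ _ _ d _) (.writeReplicate _ _ _ _ b k)) n 0
  rw [Nat.mul_zero, List.replicate_zero, List.nil_append, Nat.zero_add, Nat.add_zero] at loop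
  exact loop.mono (by ring_nf; rfl)

theorem Exec.skipWhile {b : A → Bool} (hinp : inp.head?.any b = false) {x : List A}
    (hx : ∀ a ∈ x, b a = true) :
    Exec (skipWhile b) ⟨r, x ++ inp, out, ctr⟩ ⟨r, inp, out, ctr⟩ (2 * x.length + 1) :=
  Exec.whileInp_of_forall (b := fun o => o.any b)
    (S := fun x _ => (⟨r, x ++ inp, out, ctr⟩ : State A B C R)) (fun _ _ => rfl) hinp
    (fun _ _ _ _ => .read _ _) hx []

theorem Exec.countSymbol [DecidableEq A] {a : A} (hinp : inp.head? ≠ some a) (c : C) (n : ℕ) :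
    Exec (countSymbol a c) ⟨r, List.replicate n a ++ inp, out, ctr⟩
      ⟨r, inp, out, Function.update ctr c (ctr c + n)⟩ (3 * n + 1) := by
  have loop := Exec.whileInp_of_forall (b := fun o => o = some a) (t := 1 + 1)
    (p := .seq (.read fun r _ => r) (.inc c))
    (S := fun x y => (⟨r, x ++ inp, out, Function.update ctr c (ctr c + y.length)⟩ :
      State A B C R)) (fun _ _ => rfl) (decide_eq_false hinp)
    (fun _ _ _ _ => .seq (.read _ _) (.inc_update _ _ _ _ c _))
    (x := List.replicate n a) (by simp) []
  simp only [List.length_nil, Nat.add_zero, Function.update_eq_self, List.append_nil,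
    List.length_reverse, List.length_replicate, List.nil_append] at loop
  exact loop

theorem Exec.mapReverse (f : A → B) (b : B) :
    Exec (mapReverse f b) ⟨none, inp, out, ctr⟩ ⟨none, [], (inp.map f).reverse ++ out, ctr⟩
      (4 * inp.length + 1) := by
  have loop := Exec.whileInp_of_forall (b := Option.isSome) (inp := []) (t := 1 + (1 + 1))
    (p := .seq (.read fun _ o => o) (.seq (.write fun r => r.elim b f) (.load fun _ => none)))
    (S := fun x y => (⟨none, x, y.map f ++ out, ctr⟩ : State A B C (Option A)))
    (fun x _ => (List.append_nil x).symm) rfl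
    (fun a x y _ => .seq (.read _ _) (.seq (.write _ _) (.load _ _)))
    (x := inp) (by simp) []
  simp only [List.map_nil, List.nil_append, List.append_nil, List.map_reverse] at loop
  exact loop

end CounterProgram

/-! ### Writing the polynomial of a circuit -/

/-- The encoding of a list of variables. -/
def encodeVars (m : List ℕ) : List PolySymbol :=
  m.flatMap fun i => .comma :: List.replicate i .tick

/-- The encoding of a list of monomials. -/
def encodeMonomials (ms : List (List ℕ)) : List PolySymbol :=
  ms.flatMap fun m => .plus :: encodeVars m

theorem encodeMonomials_append (ms ms' : List (List ℕ)) :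
    encodeMonomials (ms ++ ms') = encodeMonomials ms ++ encodeMonomials ms' :=
  List.flatMap_append

/-- The counters of the program for circuits: the number of the current block, the two wires read by
the current gate, and a temporary counter. -/
inductive CircuitCounter where
  | block
  | fst
  | snd
  | tmp
  deriving DecidableEq

instance : Fintype CircuitCounter :=
  ⟨{.block, .fst, .snd, .tmp}, fun c => by cases c <;> simp⟩

/-- A variable in terms of the counters: `(c, i)` is the variable `4 * n + i`, where `n` is the
value of `c`. -/
abbrev VarTemplate := CircuitCounter × ℕ

/-- The variable given by a template. -/
def VarTemplate.value (ctr : CircuitCounter → ℕ) (v : VarTemplate) : ℕ := 4 * ctr v.1 + v.2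

/-- The programs that read a circuit and write a polynomial. The register holds the type of the
current gate. -/
abbrev CircuitProgram :=
  CounterProgram CircuitSymbol PolySymbol CircuitCounter (Option CircuitSymbol)

/-- The values of the counters between two steps of the program, when `tmp` is zero. -/
def circuitCounters (k i j : ℕ) : CircuitCounter → ℕ
  | .block => k
  | .fst => i
  | .snd => j
  | .tmp => 0

theorem circuitCounters_zero : circuitCounters 0 0 0 = fun _ => 0 := by
  funext c
  cases c <;> rfl

theorem circuitCounters_le {k i j N : ℕ} (hk : k ≤ N) (hi : i ≤ N) (hj : j ≤ N) :
    ∀ c, circuitCounters k i j c ≤ N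
  | .block => hk
  | .fst => hi
  | .snd => hj
  | .tmp => Nat.zero_le N

theorem update_circuitCounters_block (k i j n : ℕ) :
    Function.update (circuitCounters k i j) .block n = circuitCounters n i j := by
  funext c
  cases c <;> rfl

theorem update_circuitCounters_fst (k i j n : ℕ) :
    Function.update (circuitCounters k i j) .fst n = circuitCounters k n j := by
  funext c
  cases c <;> rfl

theorem update_circuitCounters_snd (k i j n : ℕ) :
    Function.update (circuitCounters k i j) .snd n = circuitCounters k i n := by
  funext c
  cases c <;> rfl

namespace CircuitProgram

open CounterProgram

/-- Write a variable. -/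
def printVar (v : VarTemplate) : CircuitProgram :=
  .seq (writeReplicate .tick v.2) <| .seq (transfer v.1 .tmp .tick 4) <|
    .seq (transfer .tmp v.1 .tick 0) <| .write fun _ => .comma

/-- Write a list of variables. -/
def printVars : List VarTemplate → CircuitProgram
  | [] => skip
  | v :: vs => .seq (printVars vs) (printVar v)

/-- Write a list of monomials. -/
def printMonomials : List (List VarTemplate) → CircuitProgram
  | [] => skip
  | m :: ms => .seq (printMonomials ms) (.seq (printVars m) (.write fun _ => .plus))

variable (r : Option CircuitSymbol) (inp : List CircuitSymbol) (out : List PolySymbol)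
  {ctr : CircuitCounter → ℕ}

theorem exec_printVar {v : VarTemplate} (hv : v.1 ≠ .tmp) (hctr : ctr .tmp = 0) :
    Exec (printVar v) ⟨r, inp, out, ctr⟩ ⟨r, inp, encodeVars [v.value ctr] ++ out, ctr⟩
      (10 * ctr v.1 + v.2 + 4) := by
  have add_to_tmp := Exec.transfer (R := Option CircuitSymbol) r inp
    (List.replicate v.2 .tick ++ out) ctr hv .tick 4 (ctr v.1) 0
  have restore := Exec.transfer (R := Option CircuitSymbol) r inp
    (List.replicate (4 * ctr v.1) .tick ++ (List.replicate v.2 .tick ++ out)) ctr hv.symm .tick 0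
    (ctr v.1) 0
  have update_tmp : Function.update ctr .tmp 0 = ctr := Function.update_eq_self_iff.2 hctr.symm
  rw [Function.update_eq_self, update_tmp, Nat.zero_add] at add_to_tmp
  rw [Function.update_comm hv.symm, update_tmp, Nat.zero_add, Function.update_eq_self,
    Nat.zero_mul, List.replicate_zero, List.nil_append] at restore
  have hout : encodeVars [v.value ctr] ++ out = PolySymbol.comma ::
      (List.replicate (4 * ctr v.1) .tick ++ (List.replicate v.2 .tick ++ out)) := by
    simp only [encodeVars, VarTemplate.value, List.replicate_add, List.flatMap_singleton,
      List.cons_append, List.append_assoc]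
  rw [hout]
  exact (Exec.seq (.writeReplicate _ _ _ _ _ _)
    (add_to_tmp.seq (restore.seq (.write _ _)))).mono (by ring_nf; rfl)

theorem exists_exec_printVars {vs : List VarTemplate} (hvs : ∀ v ∈ vs, v.1 ≠ .tmp) :
    ∃ K, ∀ (r inp out) (ctr : CircuitCounter → ℕ) (N : ℕ), ctr .tmp = 0 → (∀ c, ctr c ≤ N) →
      Exec (printVars vs) ⟨r, inp, out, ctr⟩
        ⟨r, inp, encodeVars (vs.map (VarTemplate.value ctr)) ++ out, ctr⟩ (K * (N + 1)) := by
  induction vs with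
  | nil => exact ⟨1, fun r inp out ctr N _ _ => (Exec.skip _).mono (by omega)⟩
  | cons v vs ih =>
    rw [List.forall_mem_cons] at hvs
    obtain ⟨K, hK⟩ := ih hvs.2
    refine ⟨K + (v.2 + 14), fun r inp out ctr N hctr hN => ?_⟩
    have last := exec_printVar r inp (encodeVars (vs.map (VarTemplate.value ctr)) ++ out)
      hvs.1 hctr
    rw [← List.append_assoc, encodeVars, encodeVars, ← List.flatMap_append] at last
    refine ((hK r inp out ctr N hctr hN).seq last).mono ?_
    nlinarith [hN v.1, Nat.zero_le (v.2 * N)]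

theorem exists_exec_printMonomials {ms : List (List VarTemplate)}
    (hms : ∀ m ∈ ms, ∀ v ∈ m, v.1 ≠ .tmp) :
    ∃ K, ∀ (r inp out) (ctr : CircuitCounter → ℕ) (N : ℕ), ctr .tmp = 0 → (∀ c, ctr c ≤ N) →
      Exec (printMonomials ms) ⟨r, inp, out, ctr⟩
        ⟨r, inp, encodeMonomials (ms.map (List.map (VarTemplate.value ctr))) ++ out, ctr⟩
        (K * (N + 1)) := by
  induction ms with
  | nil => exact ⟨1, fun r inp out ctr N _ _ => (Exec.skip _).mono (by omega)⟩
  | cons m ms ih =>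
    rw [List.forall_mem_cons] at hms
    obtain ⟨K, hK⟩ := ih hms.2
    obtain ⟨K', hK'⟩ := exists_exec_printVars hms.1
    refine ⟨K + (K' + 1), fun r inp out ctr N hctr hN => ?_⟩
    have run := (hK r inp out ctr N hctr hN).seq
      ((hK' r inp _ ctr N hctr hN).seq (.write (fun _ => .plus) _))
    rw [List.map_cons, encodeMonomials, List.flatMap_cons, List.append_assoc]
    exact run.mono (by nlinarith)

end CircuitProgram

namespace BoolGate

/-- The second wire read by a gate, and `0` for a NOT gate. -/
def secondInput : BoolGate → ℕ
  | .and _ j => j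
  | .or _ j => j
  | .not _ => 0

theorem secondInput_le {g : BoolGate} {N : ℕ} (h : ∀ i ∈ g.inputs, i ≤ N) : g.secondInput ≤ N := by
  cases g <;> simp_all [inputs, secondInput]

theorem head?_flatMap_encode_ne_tick (gs : List BoolGate) :
    (gs.flatMap encode).head? ≠ some .tick := by
  rcases gs with _ | ⟨_ | _ | _, gs⟩ <;> simp [encode]

theorem length_le_length_flatMap_encode (gs : List BoolGate) :
    gs.length ≤ (gs.flatMap encode).length := by
  rw [List.length_flatMap, ← List.length_map (f := fun g => (encode g).length)]
  refine List.length_le_sum_of_one_le _ fun n hn => ?_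
  obtain ⟨g, -, rfl⟩ := List.mem_map.1 hn
  cases g <;> simp [encode]

/-- The symbol for the type of a gate. -/
def symbol : BoolGate → CircuitSymbol
  | .and _ _ => .and
  | .or _ _ => .or
  | .not _ => .not

/-- The monomials of the polynomial for the output of a gate, in terms of the counters. They only
depend on the type of the gate. -/
def valueTemplate : BoolGate → List (List VarTemplate)
  | .and _ _ => [[(.snd, 5), (.block, 0)]]
  | .or _ _ => [[(.snd, 5), (.block, 0)], [(.block, 0)], [(.snd, 5)]]
  | .not _ => [[(.block, 0)], []]

/-- The monomials for a gate, in terms of the counters. -/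
def template (g : BoolGate) : List (List VarTemplate) :=
  [[(.fst, 5), (.block, 2)], [(.block, 0), (.block, 2)], [(.block, 1), (.block, 3)]] ++
    g.valueTemplate.map (· ++ [(.block, 3)])

theorem map_value_template (k : ℕ) (g : BoolGate) :
    g.template.map (List.map (VarTemplate.value (circuitCounters k g.firstInput g.secondInput))) =
      BoolCircuit.gateMonomials k g := by
  cases g <;> rfl

end BoolGate

namespace CircuitProgram

open CounterProgram

/-- The monomials for an input, in terms of the counters. -/
def inputTemplate : List (List VarTemplate) :=
  [[(.block, 0), (.block, 2)], [(.fst, 0), (.block, 1), (.block, 3)], [(.block, 1), (.block, 3)]]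

/-- The monomial for the output, in terms of the counters. -/
def outputTemplate : List (List VarTemplate) := [[(.snd, 0), (.snd, 2), (.fst, 5)]]

/-- The monomials that do not depend on the circuit, in terms of the counters. -/
def baseTemplate : List (List VarTemplate) :=
  [[(.block, 0), (.block, 2)], [(.block, 0), (.block, 1), (.block, 3)], [(.block, 1), (.block, 3)]]

/-- Read a gate: its type to the register, its wires to `fst` and `snd`. -/
def readGate : CircuitProgram :=
  .seq (.read fun _ o => o) <| .seq (countSymbol .tick .fst) <|
    .ite (fun r => r = some .not) skip (.seq (.read fun r _ => r) (countSymbol .tick .snd))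

/-- Write the monomials of the current gate. -/
def printGate : CircuitProgram :=
  .ite (fun r => r = some .and) (printMonomials (BoolGate.and 0 0).template) <|
    .ite (fun r => r = some .or) (printMonomials (BoolGate.or 0 0).template)
      (printMonomials (BoolGate.not 0).template)

/-- Go to the next block. -/
def nextBlock : CircuitProgram :=
  .seq (clear .fst) <| .seq (clear .snd) <| .seq (.inc .block) (.load fun _ => none)

/-- Read the gates and write their monomials. -/
def printGates : CircuitProgram :=
  .whileInp Option.isSome (.seq readGate (.seq printGate nextBlock))

/-- Read the inputs and write their monomials. -/
def printInputs : CircuitProgram :=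
  .whileInp (fun o => o = some .tick) <|
    .seq (.read fun r _ => r) (.seq (printMonomials inputTemplate) (.inc .block))

/-- Read the output wire and write its monomial. -/
def printOutput : CircuitProgram :=
  .seq (.read fun r _ => r) <| .seq (countSymbol .tick .fst) <|
    .seq (printMonomials outputTemplate) (clear .fst)

/-- Read a circuit and write its polynomial. -/
def printCircuit : CircuitProgram :=
  .seq (printMonomials baseTemplate) <| .seq (.inc .block) <| .seq printInputs <|
    .seq printOutput <| .seq printGates (.whileCtr .block (writeReplicate .tick 4))

theorem exec_inc_block (r inp out) (k i j : ℕ) :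
    Exec (.inc .block) (⟨r, inp, out, circuitCounters k i j⟩ :
      State CircuitSymbol PolySymbol CircuitCounter (Option CircuitSymbol))
      ⟨r, inp, out, circuitCounters (k + 1) i j⟩ 1 := by
  have inc := Exec.inc_update (R := Option CircuitSymbol) r inp out (circuitCounters k i j) .block k
  rwa [update_circuitCounters_block, update_circuitCounters_block] at inc

theorem exec_clear_fst (r inp out) (k i j : ℕ) :
    Exec (clear .fst) (⟨r, inp, out, circuitCounters k i j⟩ :
      State CircuitSymbol PolySymbol CircuitCounter (Option CircuitSymbol))
      ⟨r, inp, out, circuitCounters k 0 j⟩ (2 * i + 1) := by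
  have clear := Exec.clear (R := Option CircuitSymbol) r inp out (circuitCounters k i j) .fst
  rwa [update_circuitCounters_fst] at clear

theorem exec_clear_snd (r inp out) (k i j : ℕ) :
    Exec (clear .snd) (⟨r, inp, out, circuitCounters k i j⟩ :
      State CircuitSymbol PolySymbol CircuitCounter (Option CircuitSymbol))
      ⟨r, inp, out, circuitCounters k i 0⟩ (2 * j + 1) := by
  have clear := Exec.clear (R := Option CircuitSymbol) r inp out (circuitCounters k i j) .snd
  rwa [update_circuitCounters_snd] at clear

theorem exec_countSymbol_fst {inp : List CircuitSymbol} (h : inp.head? ≠ some .tick)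
    (r out) (k i j : ℕ) :
    Exec (countSymbol .tick .fst) (⟨r, List.replicate i .tick ++ inp, out, circuitCounters k 0 j⟩ :
      State CircuitSymbol PolySymbol CircuitCounter (Option CircuitSymbol))
      ⟨r, inp, out, circuitCounters k i j⟩ (3 * i + 1) := by
  have count := Exec.countSymbol (R := Option CircuitSymbol) (B := PolySymbol) r inp out
    (circuitCounters k 0 j) h .fst i
  rwa [update_circuitCounters_fst, circuitCounters, Nat.zero_add] at count

theorem exec_countSymbol_snd {inp : List CircuitSymbol} (h : inp.head? ≠ some .tick)
    (r out) (k i j : ℕ) :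
    Exec (countSymbol .tick .snd) (⟨r, List.replicate j .tick ++ inp, out, circuitCounters k i 0⟩ :
      State CircuitSymbol PolySymbol CircuitCounter (Option CircuitSymbol))
      ⟨r, inp, out, circuitCounters k i j⟩ (3 * j + 1) := by
  have count := Exec.countSymbol (R := Option CircuitSymbol) (B := PolySymbol) r inp out
    (circuitCounters k i 0) h .snd j
  rwa [update_circuitCounters_snd, circuitCounters, Nat.zero_add] at count

theorem exec_readGate {inp : List CircuitSymbol} (h : inp.head? ≠ some .tick) (g : BoolGate)
    (r out) (k : ℕ) :
    Exec readGate ⟨r, g.encode ++ inp, out, circuitCounters k 0 0⟩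
      ⟨some g.symbol, inp, out, circuitCounters k g.firstInput g.secondInput⟩
      (3 * (g.firstInput + g.secondInput) + 5) := by
  have read_two (s : CircuitSymbol) (hs : s ≠ .not) (i j : ℕ) : Exec readGate
      ⟨r, s :: (List.replicate i .tick ++ .comma :: (List.replicate j .tick ++ inp)), out,
        circuitCounters k 0 0⟩ ⟨some s, inp, out, circuitCounters k i j⟩ (3 * (i + j) + 5) := by
    refine (Exec.seq (.read _ _) (.seq (exec_countSymbol_fst (by simp) _ _ k i 0)
      (.ite_false (by simpa) (.seq (.read _ _) (exec_countSymbol_snd h _ _ k i j))))).mono ?_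
    omega
  cases g with
  | and i j =>
    rw [BoolGate.encode, List.cons_append, List.append_assoc]
    exact read_two .and (by decide) i j
  | or i j =>
    rw [BoolGate.encode, List.cons_append, List.append_assoc]
    exact read_two .or (by decide) i j
  | not i =>
    exact (Exec.seq (.read _ _) (.seq (exec_countSymbol_fst h _ _ k i 0)
      (.ite_true rfl (.skip _)))).mono (by simp [BoolGate.firstInput, BoolGate.secondInput]; omega)

theorem exists_exec_printGate : ∃ K, ∀ (g : BoolGate) (k : ℕ) (inp out) (N : ℕ), k ≤ N →
    g.firstInput ≤ N → g.secondInput ≤ N →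
    Exec printGate
      ⟨some g.symbol, inp, out, circuitCounters k g.firstInput g.secondInput⟩
      ⟨some g.symbol, inp, encodeMonomials (BoolCircuit.gateMonomials k g) ++ out,
        circuitCounters k g.firstInput g.secondInput⟩ (K * (N + 1)) := by
  obtain ⟨Ka, print_and⟩ := exists_exec_printMonomials
    (ms := (BoolGate.and 0 0).template) (by decide)
  obtain ⟨Ko, print_or⟩ := exists_exec_printMonomials
    (ms := (BoolGate.or 0 0).template) (by decide)
  obtain ⟨Kn, print_not⟩ := exists_exec_printMonomials
    (ms := (BoolGate.not 0).template) (by decide)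
  refine ⟨Ka + Ko + Kn + 2, fun g k inp out N hk hi hj => ?_⟩
  have hN := circuitCounters_le hk hi hj
  rw [← g.map_value_template]
  cases g with
  | and i j => exact (Exec.ite_true rfl (print_and _ inp out _ N rfl hN)).mono (by nlinarith)
  | or i j =>
    exact (Exec.ite_false rfl (.ite_true rfl (print_or _ inp out _ N rfl hN))).mono
      (by nlinarith)
  | not i =>
    exact (Exec.ite_false rfl (.ite_false rfl (print_not _ inp out _ N rfl hN))).mono
      (by nlinarith)

theorem exec_nextBlock (r inp out) (k i j : ℕ) :
    Exec nextBlock ⟨r, inp, out, circuitCounters k i j⟩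
      ⟨none, inp, out, circuitCounters (k + 1) 0 0⟩ (2 * (i + j) + 4) :=
  (Exec.seq (exec_clear_fst _ _ _ k i j) (.seq (exec_clear_snd _ _ _ k 0 j)
    (.seq (exec_inc_block _ _ _ k 0 0) (.load _ _)))).mono (by omega)

theorem exists_exec_printGates : ∃ K, ∀ (gs : List BoolGate) (k : ℕ) (out) (N : ℕ),
    k + gs.length ≤ N → (∀ g ∈ gs, ∀ i ∈ g.inputs, i ≤ N) →
    Exec printGates ⟨none, gs.flatMap BoolGate.encode, out, circuitCounters k 0 0⟩
      ⟨none, [], encodeMonomials (BoolCircuit.gatesMonomials k gs) ++ out,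
        circuitCounters (k + gs.length) 0 0⟩ (K * (N + 1) * gs.length + 1) := by
  obtain ⟨K, print_gate⟩ := exists_exec_printGate
  refine ⟨K + 20, fun gs => ?_⟩
  induction gs with
  | nil => exact fun k out N _ _ => .whileInp_done rfl
  | cons g gs ih =>
    intro k out N hk hgs
    rw [List.forall_mem_cons] at hgs
    rw [List.length_cons] at hk
    have hi := hgs.1 _ g.firstInput_mem_inputs
    have hj := BoolGate.secondInput_le hgs.1
    have gate := (exec_readGate (BoolGate.head?_flatMap_encode_ne_tick gs) g none out k).seq
      ((print_gate g k _ out N (by omega) hi hj).seq (exec_nextBlock _ _ _ k _ _))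
    have rest := ih (k + 1) (encodeMonomials (BoolCircuit.gateMonomials k g) ++ out) N (by omega)
      hgs.2
    rw [Nat.add_right_comm k, ← List.append_assoc, ← encodeMonomials_append] at rest
    have hhead : (g.encode ++ gs.flatMap BoolGate.encode).head?.isSome = true := by
      cases g <;> rfl
    refine (Exec.whileInp_step hhead gate rest).mono ?_
    rw [List.length_cons]
    nlinarith

theorem exists_exec_printInputs : ∃ K, ∀ (n k : ℕ) (inp out) (N : ℕ),
    inp.head? ≠ some CircuitSymbol.tick → k + n ≤ N →
    Exec printInputs ⟨none, List.replicate n .tick ++ inp, out, circuitCounters k 0 0⟩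
      ⟨none, inp, encodeMonomials (BoolCircuit.inputsMonomials k n) ++ out,
        circuitCounters (k + n) 0 0⟩ (K * (N + 1) * n + 1) := by
  obtain ⟨K, print_input⟩ := exists_exec_printMonomials (ms := inputTemplate) (by decide)
  refine ⟨K + 3, fun n => ?_⟩
  induction n with
  | zero => exact fun k inp out N h _ => .whileInp_done (by simpa using h)
  | succ n ih =>
    intro k inp out N h hk
    have input := Exec.seq (.read (fun r _ => r) ⟨none, List.replicate (n + 1) .tick ++ inp, out,
      circuitCounters k 0 0⟩) ((print_input none (List.replicate n .tick ++ inp) out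
        (circuitCounters k 0 0) N rfl (circuitCounters_le (by omega) (Nat.zero_le N)
          (Nat.zero_le N))).seq (exec_inc_block _ _ _ k 0 0))
    have rest := ih (k + 1) inp (encodeMonomials (BoolCircuit.inputMonomials k) ++ out) N h
      (by omega)
    rw [Nat.add_right_comm k, ← List.append_assoc, ← encodeMonomials_append] at rest
    exact (Exec.whileInp_step rfl input rest).mono (by nlinarith)

theorem exists_exec_printOutput : ∃ K, ∀ (k w : ℕ) (inp out) (N : ℕ),
    inp.head? ≠ some CircuitSymbol.tick → k ≤ N → w ≤ N →
    Exec printOutput ⟨none, .comma :: (List.replicate w .tick ++ inp), out, circuitCounters k 0 0⟩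
      ⟨none, inp, encodeMonomials [[0, 2, 4 * w + 5]] ++ out, circuitCounters k 0 0⟩
      (K * (N + 1)) := by
  obtain ⟨K, print⟩ := exists_exec_printMonomials (ms := outputTemplate) (by decide)
  refine ⟨K + 8, fun k w inp out N h hk hw => ?_⟩
  have print_output := print none inp out (circuitCounters k w 0) N rfl
    (circuitCounters_le hk hw (Nat.zero_le N))
  exact (Exec.seq (.read _ _) (.seq (exec_countSymbol_fst h _ _ k w 0)
    (print_output.seq (exec_clear_fst _ _ _ k w 0)))).mono (by nlinarith)

end CircuitProgram

namespace BoolCircuit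

theorem encode_toCubic (C : BoolCircuit) : C.toCubic.encode =
    List.replicate C.polyVars .tick ++ encodeMonomials C.natMonomials := by
  refine congrArg (List.replicate C.polyVars PolySymbol.tick ++ ·) ?_
  refine (List.flatMap_map (fun m : List ℕ => m.map (Fin.ofNat C.polyVars)) _ _).trans ?_
  refine List.flatMap_congr fun m hm => congrArg (PolySymbol.plus :: ·) ?_
  refine Eq.trans ?_ (congrArg encodeVars (C.map_val_map_ofNat_of_mem_natMonomials hm))
  -- The coercion from `List (Fin n)` to `List ℕ` in `F2Poly.encode` is a monadic bind.
  exact congrArg encodeVars (bind_pure_comp Fin.val (m.map (Fin.ofNat C.polyVars)))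

theorem encode_toCubic_eq_append (C : BoolCircuit) : C.toCubic.encode =
    List.replicate (4 * (1 + C.numInputs + C.gates.length)) .tick ++
      (encodeMonomials (gatesMonomials (1 + C.numInputs) C.gates) ++
        (encodeMonomials [[0, 2, 4 * C.out + 5]] ++
          (encodeMonomials (inputsMonomials 1 C.numInputs) ++ encodeMonomials baseMonomials))) := by
  have blocks : C.numInputs + C.gates.length + 1 = 1 + C.numInputs + C.gates.length := by omega
  rw [encode_toCubic, polyVars, natMonomials, blocks, Nat.add_comm C.numInputs,
    ← List.singleton_append]
  simp only [encodeMonomials_append]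

theorem le_length_encode (C : BoolCircuit) :
    C.numInputs + 1 + C.out + C.gates.length ≤ C.encode.length := by
  have gates_le := BoolGate.length_le_length_flatMap_encode C.gates
  simp only [encode, List.length_append, List.length_cons, List.length_replicate]
  omega

theorem input_le_length_encode (C : BoolCircuit) {g : BoolGate} (hg : g ∈ C.gates) {i : ℕ}
    (hi : i ∈ g.inputs) : i ≤ C.encode.length := by
  obtain ⟨k, hk, rfl⟩ := List.mem_iff_getElem.1 hg
  have wire_lt := C.gates_wf k hk i hi
  have length_le := C.le_length_encode
  omega

end BoolCircuit

namespace CircuitProgram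

open CounterProgram

theorem exec_printVarCount (r inp out) (k : ℕ) :
    Exec (.whileCtr .block (writeReplicate .tick 4))
      (⟨r, inp, out, circuitCounters k 0 0⟩ :
        State CircuitSymbol PolySymbol CircuitCounter (Option CircuitSymbol))
      ⟨r, inp, List.replicate (4 * k) .tick ++ out, fun _ => 0⟩ (6 * k + 1) := by
  have write := Exec.whileCtr_writeReplicate (R := Option CircuitSymbol) r inp out
    (circuitCounters k 0 0) .block .tick 4
  rwa [update_circuitCounters_block, circuitCounters_zero] at write

theorem exists_exec_printCircuit : ∃ K, ∀ C : BoolCircuit,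
    Exec printCircuit ⟨none, C.encode, [], fun _ => 0⟩
      ⟨none, [], C.toCubic.encode, fun _ => 0⟩ (K * (C.encode.length + 1) ^ 2) := by
  obtain ⟨Kb, print_base⟩ := exists_exec_printMonomials (ms := baseTemplate) (by decide)
  obtain ⟨Ki, print_inputs⟩ := exists_exec_printInputs
  obtain ⟨Ko, print_output⟩ := exists_exec_printOutput
  obtain ⟨Kg, print_gates⟩ := exists_exec_printGates
  refine ⟨Kb + Ki + Ko + Kg + 10, fun C => ?_⟩
  have length_le := C.le_length_encode
  set N := C.encode.length
  have base := print_base none C.encode [] (circuitCounters 0 0 0) N rfl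
    (circuitCounters_le (Nat.zero_le N) (Nat.zero_le N) (Nat.zero_le N))
  have inputs := print_inputs C.numInputs 1
    (.comma :: (List.replicate C.out .tick ++ C.gates.flatMap BoolGate.encode))
    (encodeMonomials BoolCircuit.baseMonomials ++ []) N (by simp) (by omega)
  have output := print_output (1 + C.numInputs) C.out _
    (encodeMonomials (BoolCircuit.inputsMonomials 1 C.numInputs) ++
      (encodeMonomials BoolCircuit.baseMonomials ++ [])) N
    (BoolGate.head?_flatMap_encode_ne_tick C.gates) (by omega) (by omega)
  have gates := print_gates C.gates (1 + C.numInputs) (encodeMonomials [[0, 2, 4 * C.out + 5]] ++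
    (encodeMonomials (BoolCircuit.inputsMonomials 1 C.numInputs) ++
      (encodeMonomials BoolCircuit.baseMonomials ++ []))) N (by omega)
    fun g hg i hi => C.input_le_length_encode hg hi
  have run := base.seq ((exec_inc_block _ _ _ 0 0 0).seq (inputs.seq (output.seq
    (gates.seq (exec_printVarCount _ _ _ (1 + C.numInputs + C.gates.length))))))
  rw [List.append_nil] at run
  rw [circuitCounters_zero] at run
  rw [C.encode_toCubic_eq_append]
  refine run.mono ?_
  have linear_le : N + 1 ≤ (N + 1) ^ 2 := Nat.le_self_pow two_ne_zero _
  have base_time : Kb * (N + 1) ≤ Kb * (N + 1) ^ 2 := by gcongr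
  have inputs_time : Ki * (N + 1) * C.numInputs ≤ Ki * (N + 1) * (N + 1) := by gcongr; omega
  have output_time : Ko * (N + 1) ≤ Ko * (N + 1) ^ 2 := by gcongr
  have gates_time : Kg * (N + 1) * C.gates.length ≤ Kg * (N + 1) * (N + 1) := by gcongr; omega
  linarith

end CircuitProgram

theorem BoolCircuit.polyTimeComputable_toCubic :
    PolyTimeComputable encode CubicF2Poly.encode toCubic := by
  obtain ⟨K, print⟩ := CircuitProgram.exists_exec_printCircuit
  refine CircuitProgram.printCircuit.polyTimeComputable none
    (Polynomial.C K * (Polynomial.X + 1) ^ 2) fun C => ?_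
  simpa using print C

/-! ### Recovering the count from the gap -/

/-- The binary number without its low zeros and its lowest one: `F` for `2 ^ a * (2 * F + 1)`. -/
def stripLowestOne : PosNum → Num
  | .one => 0
  | .bit0 p => stripLowestOne p
  | .bit1 p => .pos p

theorem stripLowestOne_eq {a F : ℕ} {p : PosNum} (h : (p : ℕ) = 2 ^ a * (2 * F + 1)) :
    (stripLowestOne p : ℕ) = F := by
  induction p generalizing a with
  | one =>
    have odd_eq_one := Nat.eq_one_of_mul_eq_one_left (h.symm.trans PosNum.cast_one)
    rw [stripLowestOne, Num.cast_zero]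
    omega
  | bit0 p ih =>
    rw [PosNum.cast_bit0] at h
    cases a with
    | zero => omega
    | succ a =>
      rw [pow_succ, mul_right_comm] at h
      exact ih (a := a) (by omega)
  | bit1 p =>
    rw [PosNum.cast_bit1] at h
    cases a with
    | zero =>
      rw [stripLowestOne, Num.cast_pos]
      omega
    | succ a =>
      rw [pow_succ, mul_right_comm] at h
      omega

theorem exists_encodePosNum_eq (p : PosNum) : ∃ a, Computability.encodePosNum p =
    List.replicate a false ++ true :: Computability.encodeNum (stripLowestOne p) := by
  induction p with
  | one => exact ⟨0, rfl⟩
  | bit0 p ih =>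
    obtain ⟨a, h⟩ := ih
    exact ⟨a + 1, congrArg (false :: ·) h⟩
  | bit1 p => exact ⟨0, rfl⟩

/-- The number `F`, given the integer `2 ^ a * (2 * F + 1)`. The sign is ignored, and the value at
`0` is `0`. -/
def halveOddPart (z : ℤ) : ℕ :=
  match (z.natAbs : Num) with
  | .zero => 0
  | .pos p => stripLowestOne p

theorem halveOddPart_eq {z : ℤ} {a F : ℕ} (h : z = 2 ^ a * (2 * F + 1)) : halveOddPart z = F := by
  have natAbs_eq : ((z.natAbs : Num) : ℕ) = 2 ^ a * (2 * F + 1) := by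
    rw [Num.to_of_nat, h]
    exact Int.natAbs_natCast (2 ^ a * (2 * F + 1))
  rw [halveOddPart]
  cases hz : (z.natAbs : Num) with
  | zero =>
    rw [hz] at natAbs_eq
    exact absurd natAbs_eq.symm (by positivity : 2 ^ a * (2 * F + 1) ≠ 0)
  | pos p =>
    rw [hz] at natAbs_eq
    exact stripLowestOne_eq natAbs_eq

theorem exists_encodeInt_eq (z : ℤ) : ∃ s a rest,
    encodeInt z = s :: (List.replicate a false ++ rest) ∧ rest.head? ≠ some false ∧
      rest.tail = Computability.encodeNat (halveOddPart z) := by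
  rw [encodeInt, halveOddPart, Computability.encodeNat]
  cases (z.natAbs : Num) with
  | zero => exact ⟨_, 0, [], rfl, by simp, rfl⟩
  | pos p =>
    obtain ⟨a, h⟩ := exists_encodePosNum_eq p
    refine ⟨_, a, _, congrArg (_ :: ·) h, by simp, ?_⟩
    rw [Computability.encodeNat, Num.of_to_nat, List.tail_cons]

section HalveOddPart

open CounterProgram

/-- Skip the first component of a pair, then the sign, the low zeros and the lowest one of the
integer, and write the remaining digits in reverse order. -/
def halveOddPartProgram : CounterProgram (Bool ⊕ Bool) Bool Empty (Option (Bool ⊕ Bool)) :=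
  .seq (skipWhile Sum.isLeft) <| .seq (.read fun r _ => r) <|
    .seq (skipWhile fun x => x = .inr false) <| .seq (.read fun r _ => r) <|
      mapReverse (Sum.elim id id) false

theorem exec_halveOddPartProgram (w : List Bool) (z : ℤ) :
    Exec halveOddPartProgram ⟨none, encodePair id encodeInt (w, z), [], fun _ => 0⟩
      ⟨none, [], (Computability.encodeNat (halveOddPart z)).reverse, fun _ => 0⟩
      (4 * (encodePair id encodeInt (w, z)).length + 5) := by
  obtain ⟨s, a, rest, hz, head_ne, tail_eq⟩ := exists_encodeInt_eq z
  have input_eq : encodePair id encodeInt (w, z) = w.map .inl ++ (.inr s ::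
      (List.replicate a (.inr false) ++ rest.map .inr)) := by
    simp [encodePair, hz]
  have head_any : (rest.map (.inr : Bool → Bool ⊕ Bool)).head?.any (fun x => x = .inr false) =
      false := by
    cases rest <;> simp_all
  have copy := Exec.mapReverse (C := Empty) (rest.map (.inr : Bool → Bool ⊕ Bool)).tail []
    (fun _ => 0) (Sum.elim id id) false
  rw [← List.map_tail, List.map_map, Sum.elim_comp_inr, List.map_id, List.append_nil, List.map_tail,
    tail_eq] at copy
  rw [input_eq]
  refine (Exec.seq (.skipWhile none _ [] _ rfl (by simp)) (.seq (.read _ _)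
    (.seq (.skipWhile none _ [] _ head_any (by simp)) (.seq (.read _ _) copy)))).mono ?_
  simp only [List.length_append, List.length_cons, List.length_map, List.length_replicate,
    List.length_tail]
  omega

theorem polyTimeComputable_reverse_halveOddPart :
    PolyTimeComputable (encodePair (id : List Bool → List Bool) encodeInt)
      (fun n => (Computability.encodeNat n).reverse) (fun p => halveOddPart p.2) :=
  halveOddPartProgram.polyTimeComputable none (4 * Polynomial.X + 5) fun p => by
    simpa using exec_halveOddPartProgram p.1 p.2

theorem polyTimeComputable_id_of_reverse {α : Type} (e : α → List Bool) :
    PolyTimeComputable (fun a => (e a).reverse) e id := by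
  refine (mapReverse id false : CounterProgram Bool Bool Empty _).polyTimeComputable none
    (4 * Polynomial.X + 1) fun a => ?_
  simpa using Exec.mapReverse (C := Empty) (e a).reverse [] (fun _ => 0) id false

theorem polyTimeComputable_halveOddPart :
    PolyTimeComputable (encodePair (id : List Bool → List Bool) encodeInt)
      Computability.encodeNat (fun p => halveOddPart p.2) :=
  (polyTimeComputable_id_of_reverse _).comp polyTimeComputable_reverse_halveOddPart

end HalveOddPart

instance : Inhabited CircuitSymbol := ⟨.tick⟩

theorem proposition2 :
    SharpPHard CubicF2Poly.encode encodeInt CubicF2Poly.gap := by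
  rintro F ⟨C, hC, hF⟩
  refine ⟨fun w => (C w).toCubic, fun p => halveOddPart p.2,
    BoolCircuit.polyTimeComputable_toCubic.comp hC, polyTimeComputable_halveOddPart, fun w => ?_⟩
  have gap_eq : (C w).toCubic.gap =
      2 ^ (2 * ((C w).numInputs + (C w).gates.length + 1)) * (2 * ((C w).count : ℕ) + 1) := by
    rw [(C w).gap_toCubic, pow_mul]
    norm_num
  exact (hF w).trans (halveOddPart_eq gap_eq).symm
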